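/- **Definitions.** Let $n,k\ge 0$ be integers. *Trees.* A complete binary tree $T$ is a rooted plane tree in which every vertex has either no children (a leaf) or two children, one joined by a horizontal (left) edge and one by a vertical (up) edge; the root has two children. $\mathcal{T}_{n,k,4}$ is the set of those with $n-2$ leaves, exactly $k+1$ of which are incident to a horizontal edge (so $n\ge 4$, $k\le n-4$). The leaves are labeled $2,\dots,n-1$ clockwise, from the leaf reached from the root by horizontal edges only to the leaf reached by vertical edges only. *The graph $G(T)$.* This is the plabic graph (planar graph drawn in a disk, with boundary vertices $1,\dots,n$ in clockwise order and internal vertices coloured black or white) obtained as follows. Each vertex $p$ of $T$ gives a white vertex $w_p$ and a black vertex $b_p$ joined by an edge, with $w_p$ on the left and $b_p$ on the right when looking from the parent of $p$ towards $p$ (for the root, $w_p$ is at the lower end and $b_p$ at the right end of the side that faces away from the children). If $p$ has horizontal child $h$ and vertical child $v$, add the edges $w_pw_h$, $b_hw_v$, $b_vb_p$, so that $p$ becomes a hexagonal face. Join boundary vertex $1$ to $w_{\mathrm{root}}$ and boundary vertex $n$ to $b_{\mathrm{root}}$. For the leaf labeled $i$, join boundary vertex $i$ to $b_i$ if the leaf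 is incident to a horizontal edge, and to $w_i$ if it is incident to a vertical edge; the other one of $w_i,b_i$ is bivalent and is contracted into its neighbour of the same colour. The permutation $\pi_{G(T)}$ of $[n]$ sends $i$ to the boundary vertex at which the path ends that starts at boundary vertex $i$ and turns maximally right at every black vertex and maximally left at every white vertex. *From trees to paths.* Lattice paths in a $k\times(n-k-4)$ rectangle run from the northeast to the southwest corner and are written as words in $H$ (step west) and $V$ (step south). $\mathcal{L}_{n,k,4}$ is the set of pairs $(W_U,W_L)$ of such paths with $W_L$ weakly below $W_U$. For a complete binary tree $T$ whose root has horizontal and vertical subtrees $T'_H$, $T'_V$, define words recursively by $$W_U(T)=A_H\cdot A_V,\qquad W_L(T)=B_H\cdot B_V,$$ where $A_H,B_H$ are empty if $T'_H$ is a single leaf and otherwise $A_H=H\cdot W_U(T'_H)$, $B_H=W_L(T'_H)\cdot H$; and $A_V,B_V$ are empty if $T'_V$ is a single leaf and otherwise $A_V=V\cdot W_U(T'_V)$, $B_V=V\cdot W_L(T'_V)$. Then $\Omega_{\mathcal{TL}}(T)=(W_U(T),W_L(T))$ defines a map $\mathcal{T}_{n,k,4}\to\mathcal{L}_{n,k,4}$.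 *From paths to diagrams.* A $\oplus$-diagram of type $(k,n)$ is a filling with the symbols $0$ and $+$ of the boxes of a Young diagram that fits inside a $k\times(n-k)$ rectangle. For $(W_U,W_L)\in\mathcal{L}_{n,k,4}$, let $Y_U$ and $Y_L$ be the Young diagrams with southeast borders $W_U$ and $W_L$. The diagram $\Omega_{\mathcal{LD}}(W_U,W_L)$ is obtained as follows. (1) Its Young diagram is $Y_L$ with $4$ columns of height $k$ added at the left; place a $+$ at the far left and the far right end of each row, leaving the other boxes empty. (2) For each column of $Y_U$, from left to right, if $i$ is its height, place a top-justified column of $i$ $0$'s in empty boxes, as far right as possible. (3) In each row, place two $+$'s in empty boxes, as far right as possible. (4) Fill the remaining boxes with $0$'s. *The decorated permutation of a diagram.* A decorated permutation of $[n]$ is a permutation of $[n]$ with each fixed point coloured black or white. For a $\oplus$-diagram $D$ of type $(k,n)$, label the steps of the southeast border of its Young diagram, as a path from the northeast to the southwest corner of the $k\times(n-k)$ rectangle, by $1,\dots,n$, and give each edge of the northwest border the label of the opposite edge of the southeast border (in the same row or column). From each edge of the southeast border follow a pipe that moves west or north: in a box containing $0$ it goes straight on, and in a box containing $+$ it turns,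 from moving west to moving north or from moving north to moving west. Then $\pi_D(i)=j$ if the pipe starting at label $i$ ends at label $j$ of the northwest border; a fixed point $i$ is black if it labels horizontal edges and white if it labels vertical edges. **Theorem.** For all $n,k$ and every $T\in\mathcal{T}_{n,k,4}$, with $D=\Omega_{\mathcal{LD}}(\Omega_{\mathcal{TL}}(T))$, we have the equality of decorated permutations $$\pi_D=c_n^2\,\pi_{G(T)},$$ where $c_n=(n\;\;n{-}1\;\cdots\;2\;\;1)$ is the long cycle, $c_n(i)=i-1$ for $i\ge 2$ and $c_n(1)=n$, products are composed from right to left, and all fixed points of $c_n^2\,\pi_{G(T)}$ are coloured black. -/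

import Mathlib

namespace BCFW

/-! ## Decorated permutations -/

/-- A decorated permutation of `{1, …, n}`; the label `i` is the element `i - 1` of `Fin n`.
`white` is the set of white fixed points; all other fixed points are black. -/
@[ext]
structure DecoratedPerm (n : ℕ) where
  perm : Equiv.Perm (Fin n)
  white : Set (Fin n)
  white_fixed : ∀ i ∈ white, perm i = i

/-- The decorated permutation with underlying permutation `π` and all fixed points black. -/
def DecoratedPerm.allBlack {n : ℕ} (π : Equiv.Perm (Fin n)) : DecoratedPerm n where
  perm := π
  white := ∅
  white_fixed := fun _ h => absurd h (Set.notMem_empty _)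

/-- The long cycle `c_n = (n n-1 ⋯ 2 1)`, sending `i` to `i - 1` and `1` to `n`. -/
def longCycle (n : ℕ) : Equiv.Perm (Fin n) := (finRotate n)⁻¹

/-! ## Diagrams filled with `0` and `+`, and their pipe dreams -/

/-- A `⊕`-diagram of type `(k, n)`: a Young diagram (English notation, the box `(r, c)` lies in
row `r` from the top and column `c` from the left, both counted from `0`) that fits inside a
`k × (n - k)` rectangle, whose boxes are filled with `0` and `+`.
The set `plus` consists of the boxes filled with `+`. -/
structure OplusDiagram (k n : ℕ) where
  shape : YoungDiagram
  k_le : k ≤ n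
  fits : ∀ x ∈ shape, x.1 < k ∧ x.2 < n - k
  plus : Finset (ℕ × ℕ)
  plus_subset : ∀ x ∈ plus, x ∈ shape

/-- Unit edges of the grid. `vert r c` is the vertical edge in row `r` that has exactly `c` boxes
to its left, `horiz r c` is the horizontal edge in column `c` that has exactly `r` boxes above it.
So the box `(r, c)` has left edge `vert r c`, right edge `vert r (c + 1)`,
top edge `horiz r c` and bottom edge `horiz (r + 1) c`. -/
inductive GridEdge where
  | vert (r c : ℕ)
  | horiz (r c : ℕ)

namespace OplusDiagram

variable {k n : ℕ} (D : OplusDiagram k n)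

/-- The (zero-based) label of the vertical step in row `r` of the southeast border: the number of
steps that precede it on the way from the northeast corner of the rectangle. -/
def rowLabel (r : ℕ) : ℕ := r + (n - k - D.shape.rowLen r)

/-- The (zero-based) label of the horizontal step in column `c` of the southeast border. -/
def colLabel (c : ℕ) : ℕ := (n - k - 1 - c) + D.shape.colLen c

/-- Follow a pipe from a grid edge, moving west through a vertical edge and north through a
horizontal edge, up to the northwest border, and return the label of the edge of the northwest
border that is reached, which is the label of the opposite edge of the southeast border.
In a box filled with `+` there is an elbow, which joins the right edge to the top edge and the
bottom edge to the left edge; in a box filled with `0` the pipe goes straight on. -/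
def pipeEnd : GridEdge → ℕ
  | .vert r 0 => D.rowLabel r
  | .vert r (c + 1) =>
      if (r, c) ∈ D.plus then pipeEnd (.horiz r c) else pipeEnd (.vert r c)
  | .horiz 0 c => D.colLabel c
  | .horiz (r + 1) c =>
      if (r, c) ∈ D.plus then pipeEnd (.vert r c) else pipeEnd (.horiz r c)
termination_by e => match e with
  | .vert r c => r + c
  | .horiz r c => r + c

/-- The edge of the southeast border in a given row (`inl`) or column (`inr`). -/
def borderEdge : Fin k ⊕ Fin (n - k) → GridEdge
  | .inl r => .vert r (D.shape.rowLen r)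
  | .inr c => .horiz (D.shape.colLen c) c

lemma rowLen_le (r : ℕ) : D.shape.rowLen r ≤ n - k := by
  by_contra h
  have h1 : (r, n - k) ∈ D.shape := YoungDiagram.mem_iff_lt_rowLen.2 (by omega)
  have := (D.fits _ h1).2
  simp at this

lemma colLen_le (c : ℕ) : D.shape.colLen c ≤ k := by
  by_contra h
  have h1 : (k, c) ∈ D.shape := YoungDiagram.mem_iff_lt_colLen.2 (by omega)
  have := (D.fits _ h1).1
  simp at this

lemma rowLabel_lt {r : ℕ} (hr : r < k) : D.rowLabel r < n := by
  have := D.k_le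
  unfold rowLabel
  omega

lemma colLabel_lt {c : ℕ} (hc : c < n - k) : D.colLabel c < n := by
  have := D.colLen_le c
  unfold colLabel
  omega

/-- The labelling of the southeast border of the diagram. -/
def borderLabel : Fin k ⊕ Fin (n - k) → Fin n
  | .inl r => ⟨D.rowLabel r, D.rowLabel_lt r.2⟩
  | .inr c => ⟨D.colLabel c, D.colLabel_lt c.2⟩

lemma rowLabel_ne_colLabel (r : Fin k) (c : Fin (n - k)) : D.rowLabel r ≠ D.colLabel c := by
  have h1 := D.rowLen_le r
  have h2 := D.colLen_le c
  have h3 := c.2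
  have h4 : (c : ℕ) < D.shape.rowLen r ↔ (r : ℕ) < D.shape.colLen c := by
    rw [← YoungDiagram.mem_iff_lt_rowLen, ← YoungDiagram.mem_iff_lt_colLen]
  unfold rowLabel colLabel
  omega

lemma borderLabel_injective : Function.Injective D.borderLabel := by
  rintro (r | c) (r' | c') h
  · have h0 : D.rowLabel r = D.rowLabel r' := congrArg Fin.val h
    have h1 := D.rowLen_le r
    have h2 := D.rowLen_le r'
    unfold rowLabel at h0
    rcases le_total (r : ℕ) r' with hr | hr
    · have := D.shape.rowLen_anti _ _ hr
      congr 1; ext; omega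
    · have := D.shape.rowLen_anti _ _ hr
      congr 1; ext; omega
  · exact absurd (congrArg Fin.val h) (D.rowLabel_ne_colLabel r c')
  · exact absurd (congrArg Fin.val h).symm (D.rowLabel_ne_colLabel r' c)
  · have h0 : D.colLabel c = D.colLabel c' := congrArg Fin.val h
    have h1 := c.2
    have h2 := c'.2
    unfold colLabel at h0
    rcases le_total (c : ℕ) c' with hr | hr
    · have := D.shape.colLen_anti _ _ hr
      congr 1; ext; omega
    · have := D.shape.colLen_anti _ _ hr
      congr 1; ext; omega

lemma borderLabel_bijective : Function.Bijective D.borderLabel := by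
  rw [Fintype.bijective_iff_injective_and_card]
  refine ⟨D.borderLabel_injective, ?_⟩
  have := D.k_le
  simp
  omega

/-- The labelling of the southeast border, as a bijection. -/
noncomputable def border : Fin k ⊕ Fin (n - k) ≃ Fin n :=
  Equiv.ofBijective _ D.borderLabel_bijective

/-- Edges between boxes of the diagram, or on its border. -/
def Inside : GridEdge → Prop
  | .vert r c => r < k ∧ c ≤ D.shape.rowLen r
  | .horiz r c => c < n - k ∧ r ≤ D.shape.colLen c

lemma inside_borderEdge (s : Fin k ⊕ Fin (n - k)) : D.Inside (D.borderEdge s) := by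
  rcases s with r | c
  · exact ⟨r.2, le_rfl⟩
  · exact ⟨c.2, le_rfl⟩

lemma pipeEnd_lt (e : GridEdge) (he : D.Inside e) : D.pipeEnd e < n := by
  fun_induction pipeEnd D e with
  | case1 r => exact D.rowLabel_lt he.1
  | case2 r c h ih =>
    have h1 := D.fits _ (D.plus_subset _ h)
    have h2 := YoungDiagram.mem_iff_lt_colLen.1 (D.plus_subset _ h)
    exact ih ⟨h1.2, h2.le⟩
  | case3 r c h ih => exact ih ⟨he.1, (Nat.le_succ c).trans he.2⟩
  | case4 c => exact D.colLabel_lt he.1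
  | case5 r c h ih =>
    have h1 := D.fits _ (D.plus_subset _ h)
    have h2 := YoungDiagram.mem_iff_lt_rowLen.1 (D.plus_subset _ h)
    exact ih ⟨h1.1, h2.le⟩
  | case6 r c h ih => exact ih ⟨he.1, (Nat.le_succ r).trans he.2⟩

/-- The label at which the pipe that starts at the label `i` of the southeast border ends. -/
noncomputable def pipe (i : Fin n) : Fin n :=
  ⟨D.pipeEnd (D.borderEdge (D.border.symm i)), D.pipeEnd_lt _ (D.inside_borderEdge _)⟩

lemma exists_border_pipeEnd (N : ℕ) : ∀ e : GridEdge, D.Inside e →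
    (match e with | .vert r c => n ≤ r + c + N | .horiz r c => n ≤ r + c + N) →
    ∃ s, D.pipeEnd (D.borderEdge s) = D.pipeEnd e := by
  have hk := D.k_le
  induction N with
  | zero =>
    rintro (⟨r, c⟩ | ⟨r, c⟩) ⟨h1, h2⟩ h
    · have := D.rowLen_le r
      simp only at h
      omega
    · have := D.colLen_le c
      simp only at h
      omega
  | succ N ih =>
    rintro (⟨r, c⟩ | ⟨r, c⟩) ⟨h1, h2⟩ h
    · simp only at h
      rcases h2.eq_or_lt with h3 | h3
      · exact ⟨.inl ⟨r, h1⟩, by rw [h3]; rfl⟩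
      · have hm : (r, c) ∈ D.shape := YoungDiagram.mem_iff_lt_rowLen.2 h3
        by_cases hp : (r, c) ∈ D.plus
        · obtain ⟨s, hs⟩ := ih (.horiz (r + 1) c)
            ⟨(D.fits _ hm).2, YoungDiagram.mem_iff_lt_colLen.1 hm⟩ (by simp only; omega)
          exact ⟨s, by rw [hs, pipeEnd, if_pos hp]⟩
        · obtain ⟨s, hs⟩ := ih (.vert r (c + 1)) ⟨h1, h3⟩ (by simp only; omega)
          exact ⟨s, by rw [hs, pipeEnd, if_neg hp]⟩
    · simp only at h
      rcases h2.eq_or_lt with h3 | h3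
      · exact ⟨.inr ⟨c, h1⟩, by rw [h3]; rfl⟩
      · have hm : (r, c) ∈ D.shape := YoungDiagram.mem_iff_lt_colLen.2 h3
        by_cases hp : (r, c) ∈ D.plus
        · obtain ⟨s, hs⟩ := ih (.vert r (c + 1))
            ⟨(D.fits _ hm).1, YoungDiagram.mem_iff_lt_rowLen.1 hm⟩ (by simp only; omega)
          exact ⟨s, by rw [hs, pipeEnd, if_pos hp]⟩
        · obtain ⟨s, hs⟩ := ih (.horiz (r + 1) c) ⟨h1, h3⟩ (by simp only; omega)
          exact ⟨s, by rw [hs, pipeEnd, if_neg hp]⟩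

lemma pipe_bijective : Function.Bijective D.pipe := by
  rw [← Finite.surjective_iff_bijective]
  intro j
  obtain ⟨s, rfl⟩ := D.border.surjective j
  suffices h : ∃ s', D.pipeEnd (D.borderEdge s') = (D.border s : ℕ) by
    obtain ⟨s', hs'⟩ := h
    exact ⟨D.border s', Fin.ext (by simp [pipe, hs'])⟩
  rcases s with r | c
  · obtain ⟨s', hs'⟩ := D.exists_border_pipeEnd n (.vert r 0) ⟨r.2, Nat.zero_le _⟩
      (by simp only; omega)
    exact ⟨s', by rw [hs', pipeEnd]; rfl⟩
  · obtain ⟨s', hs'⟩ := D.exists_border_pipeEnd n (.horiz 0 c) ⟨c.2, Nat.zero_le _⟩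
      (by simp only; omega)
    exact ⟨s', by rw [hs', pipeEnd]; rfl⟩

/-- The decorated permutation `π_D`: pipes are followed from the southeast border to the northwest
border. A fixed point is white if it labels vertical edges, and black if it labels horizontal
edges. -/
noncomputable def decPerm : DecoratedPerm n where
  perm := Equiv.ofBijective D.pipe D.pipe_bijective
  white := {i | D.pipe i = i ∧ ∃ r : Fin k, D.border (.inl r) = i}
  white_fixed := fun _ h => h.1

end OplusDiagram

/-! ## Plabic graphs -/

/-- The two colours of the internal vertices of a plabic graph. -/
inductive Color where
  | black
  | white
  deriving DecidableEq

/-- The combinatorial map of a bicoloured graph with `n` boundary vertices. A plabic graph, that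
is a planar bicoloured graph drawn in a disk up to homotopy, is recorded by its edges and the
clockwise order of the edges around each vertex.
A dart is an edge together with one of its two ends, its source; `rev` passes to the same edge with
the other end; `cw` passes to the next dart in clockwise order around the same source. So edges are
the orbits of `rev` and vertices are the orbits of `cw`. `color d` is the colour of the source of
`d`, with value `none` if the source is a boundary vertex, and `bdry i` is the unique dart at the
`i`-th boundary vertex. -/
structure BicoloredMap (n : ℕ) where
  Dart : Type
  finite_dart : Finite Dart
  rev : Dart → Dart
  rev_rev : ∀ d, rev (rev d) = d
  rev_ne : ∀ d, rev d ≠ d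
  cw : Equiv.Perm Dart
  color : Dart → Option Color
  color_cw : ∀ d, color (cw d) = color d
  bdry : Fin n → Dart
  bdry_injective : Function.Injective bdry
  cw_bdry : ∀ i, cw (bdry i) = bdry i
  color_eq_none : ∀ d, color d = none ↔ ∃ i, d = bdry i

namespace BicoloredMap

variable {n : ℕ} (G : BicoloredMap n)

/-- The rules of the road: after traversing the dart `d`, turn maximally right at a black vertex
(the next dart counterclockwise from the reversed dart) and maximally left at a white vertex
(the next dart clockwise from the reversed dart). At a boundary vertex one turns back, but trips
stop there. -/
def step (d : G.Dart) : G.Dart :=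
  match G.color (G.rev d) with
  | some .black => G.cw.symm (G.rev d)
  | some .white => G.cw (G.rev d)
  | none => G.rev d

lemma color_cw_symm (d : G.Dart) : G.color (G.cw.symm d) = G.color d := by
  conv_rhs => rw [← G.cw.apply_symm_apply d, G.color_cw]

lemma color_step (d : G.Dart) : G.color (G.step d) = G.color (G.rev d) := by
  unfold step
  split <;> simp [G.color_cw, G.color_cw_symm]

lemma rev_injective : Function.Injective G.rev := fun d e h => by
  rw [← G.rev_rev d, h, G.rev_rev]

lemma step_injective : Function.Injective G.step := by
  intro d e h
  have hc : G.color (G.rev d) = G.color (G.rev e) := by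
    rw [← G.color_step, h, G.color_step]
  apply G.rev_injective
  unfold step at h
  rw [hc] at h
  split at h
  · exact G.cw.symm.injective h
  · exact G.cw.injective h
  · exact h

lemma eq_rev_bdry_of_step {d : G.Dart} {i : Fin n} (h : G.step d = G.bdry i) :
    ∃ j, d = G.rev (G.bdry j) := by
  have h1 : G.color (G.rev d) = none := by
    rw [← G.color_step, h]
    exact (G.color_eq_none _).2 ⟨i, rfl⟩
  obtain ⟨j, hj⟩ := (G.color_eq_none _).1 h1
  exact ⟨j, by rw [← hj, G.rev_rev]⟩

lemma exists_trip (i : Fin n) : ∃ m, ∃ j, G.step^[m] (G.bdry i) = G.rev (G.bdry j) := by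
  have := G.finite_dart
  obtain ⟨N, hN, hp⟩ := G.step_injective.mem_periodicPts (G.bdry i)
  obtain ⟨m, rfl⟩ := Nat.exists_eq_succ_of_ne_zero hN.ne'
  refine ⟨m, G.eq_rev_bdry_of_step (i := i) ?_⟩
  rw [← Function.iterate_succ_apply' G.step]
  exact hp

open Classical in
/-- The number of steps after which the trip from the boundary vertex `i` first runs into a
boundary vertex. -/
noncomputable def tripLength (i : Fin n) : ℕ := Nat.find (G.exists_trip i)

lemma tripLength_spec (i : Fin n) :
    ∃ j, G.step^[G.tripLength i] (G.bdry i) = G.rev (G.bdry j) := by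
  classical
  exact Nat.find_spec (G.exists_trip i)

/-- The boundary vertex at which the trip from the boundary vertex `i` ends. -/
noncomputable def tripEnd (i : Fin n) : Fin n := Classical.choose (G.tripLength_spec i)

lemma tripEnd_spec (i : Fin n) :
    G.step^[G.tripLength i] (G.bdry i) = G.rev (G.bdry (G.tripEnd i)) :=
  Classical.choose_spec (G.tripLength_spec i)

lemma not_boundary_of_lt_tripLength {i : Fin n} {m : ℕ} (h : m < G.tripLength i) :
    ¬ ∃ j, G.step^[m] (G.bdry i) = G.rev (G.bdry j) := by
  classical
  exact Nat.find_min (G.exists_trip i) h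

lemma tripEnd_injective : Function.Injective G.tripEnd := by
  have key : ∀ i i', G.tripLength i ≤ G.tripLength i' → G.tripEnd i = G.tripEnd i' → i = i' := by
    intro i i' hle h
    have h1 : G.step^[G.tripLength i] (G.bdry i) =
        G.step^[G.tripLength i] (G.step^[G.tripLength i' - G.tripLength i] (G.bdry i')) := by
      rw [← Function.iterate_add_apply, Nat.add_sub_cancel' hle, G.tripEnd_spec, G.tripEnd_spec, h]
    have h2 := G.step_injective.iterate _ h1
    rcases Nat.eq_zero_or_eq_succ_pred (G.tripLength i' - G.tripLength i) with h3 | h3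
    · rw [h3] at h2
      exact G.bdry_injective h2
    · exfalso
      rw [h3, Function.iterate_succ_apply'] at h2
      have h4 := G.eq_rev_bdry_of_step h2.symm
      refine G.not_boundary_of_lt_tripLength ?_ h4
      simp only [Nat.pred_eq_sub_one, Nat.succ_eq_add_one] at h3 ⊢
      omega
  intro i i' h
  rcases le_total (G.tripLength i) (G.tripLength i') with hle | hle
  · exact key i i' hle h
  · exact (key i' i hle h.symm).symm

/-- The permutation `π_G` given by the trips of the plabic graph. -/
noncomputable def tripPerm : Equiv.Perm (Fin n) :=
  Equiv.ofBijective G.tripEnd (Finite.injective_iff_bijective.1 G.tripEnd_injective)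

end BicoloredMap

/-! ## Complete binary trees -/

/-- The letters `H` (horizontal) and `V` (vertical). -/
inductive Step where
  | H
  | V
  deriving DecidableEq

/-- The number of leaves that are joined to their parent by a horizontal edge. Here and below the
left subtree in `BinaryTree.node` hangs on a horizontal edge, the right subtree on a
vertical edge, and `nil` stands for a leaf. -/
def horizontalLeaves : BinaryTree Unit → ℕ
  | .nil => 0
  | .node _ .nil tV => 1 + horizontalLeaves tV
  | .node _ (.node a tH tH') tV => horizontalLeaves (.node a tH tH') + horizontalLeaves tV

/-- `𝒯_{n,k,4}`: complete binary trees whose root has two children, with `n - 2` leaves, exactly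
`k + 1` of which are incident to a horizontal edge. -/
structure CompleteTree (n k : ℕ) where
  tree : BinaryTree Unit
  ne_nil : tree ≠ .nil
  leaves : tree.numLeaves + 2 = n
  horizontal : horizontalLeaves tree = k + 1

/-! ## The plabic graph of a tree -/

/-- The child of the root reached by a horizontal or a vertical edge, if there is one. -/
def child : Step → BinaryTree Unit → Option (BinaryTree Unit)
  | _, .nil => none
  | .H, .node _ tH _ => some tH
  | .V, .node _ _ tV => some tV

/-- A vertex of a tree is given by its address: the list of the steps from the root to the
vertex, the last step first. `subtreeAt T p` is the subtree at the address `p`, if `p` is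
the address of a vertex of `T`. -/
def subtreeAt (T : BinaryTree Unit) : List Step → Option (BinaryTree Unit)
  | [] => some T
  | s :: p => (subtreeAt T p).bind (child s)

/-- The addresses of the leaves of the subtree `T` at the address `p`, in clockwise order. -/
def leavesFrom : BinaryTree Unit → List Step → List (List Step)
  | .nil, p => [p]
  | .node _ tH tV, p => leavesFrom tH (.H :: p) ++ leavesFrom tV (.V :: p)

/-- The addresses of the leaves of `T`, in clockwise order. -/
def leafList (T : BinaryTree Unit) : List (List Step) := leavesFrom T []

/-- Names of the darts that belong to a vertex `p` of the tree. An internal vertex `p`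
contributes a white vertex `w_p` and a black vertex `b_p` of the plabic graph, a leaf `p`
contributes one vertex.
* `wOut`, `bOut`: the darts at `w_p` and at `b_p` that leave the part of the graph which comes from
  `p` and its descendants (for a leaf `p`, both are darts of its only vertex);
* `wb`, `bw`: the dart from `w_p` to `b_p` and the dart from `b_p` to `w_p`;
* `wH`: the dart from `w_p` towards the horizontal child of `p`;
* `bV`: the dart from `b_p` towards the vertical child of `p`;
* `leaf`: the dart from the vertex of a leaf `p` to the boundary. -/
inductive Port where
  | wOut
  | bOut
  | wb
  | bw
  | wH
  | bV
  | leaf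
  deriving DecidableEq

instance : Fintype Port :=
  ⟨{.wOut, .bOut, .wb, .bw, .wH, .bV, .leaf}, by intro x; cases x <;> decide⟩

/-- Darts: one at each boundary vertex, and those at the internal vertices. -/
inductive RawDart (n : ℕ) where
  | bdry (i : Fin n)
  | at (p : List Step) (x : Port)
  deriving DecidableEq

/-- The ports that exist at a vertex of the tree. -/
def ValidPort (T : BinaryTree Unit) (p : List Step) (x : Port) : Prop :=
  match subtreeAt T p with
  | none => False
  | some .nil => x = .wOut ∨ x = .bOut ∨ x = .leaf
  | some (.node _ _ _) => x ≠ .leaf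

/-- The darts of the plabic graph of `T`. -/
def ValidDart {n : ℕ} (T : BinaryTree Unit) : RawDart n → Prop
  | .bdry _ => True
  | .at p x => ValidPort T p x

/-- The other half of each edge. The face that replaces an internal vertex `p` of the tree has the
six sides `w_p b_p`, `b_p b_V`, `b_V w_V`, `w_V b_H`, `b_H w_H`, `w_H w_p`, where `H` and `V` denote
the two children of `p`. At a leaf the two vertices of the corresponding side
are reduced to one by contracting the bivalent one. The root carries the boundary vertices `1` and
`n`, and the leaves in clockwise order carry the boundary vertices `2, …, n - 1`. -/
def rawRev {n : ℕ} (T : BinaryTree Unit) (hn : T.numLeaves + 2 = n) : RawDart n → RawDart n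
  | .at p .wb => .at p .bw
  | .at p .bw => .at p .wb
  | .at p .wH => .at (.H :: p) .wOut
  | .at (.H :: p) .wOut => .at p .wH
  | .at (.H :: p) .bOut => .at (.V :: p) .wOut
  | .at (.V :: p) .wOut => .at (.H :: p) .bOut
  | .at (.V :: p) .bOut => .at p .bV
  | .at p .bV => .at (.V :: p) .bOut
  | .at [] .wOut => .bdry ⟨0, by omega⟩
  | .at [] .bOut => .bdry ⟨n - 1, by omega⟩
  | .at p .leaf =>
      if h : (leafList T).idxOf p + 1 < n then .bdry ⟨(leafList T).idxOf p + 1, h⟩ else .at p .leaf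
  | .bdry i =>
      if (i : ℕ) = 0 then .at [] .wOut
      else if (i : ℕ) = n - 1 then .at [] .bOut
      else .at ((leafList T).getD (i - 1) []) .leaf

/-- Whether the address `p` is that of a leaf of `T`. -/
def isLeafAt (T : BinaryTree Unit) (p : List Step) : Bool :=
  match subtreeAt T p with
  | some .nil => true
  | _ => false

/-- The next dart in clockwise order around the same vertex. Around `w_p` the clockwise order is
`wb`, `wOut`, `wH`; around `b_p` it is `bw`, `bV`, `bOut`; around the vertex of a leaf it is `leaf`,
`bOut`, `wOut`. -/
def rawCw {n : ℕ} (T : BinaryTree Unit) : RawDart n → RawDart n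
  | .bdry i => .bdry i
  | .at p .wb => .at p .wOut
  | .at p .wH => .at p .wb
  | .at p .bw => .at p .bV
  | .at p .bV => .at p .bOut
  | .at p .leaf => .at p .bOut
  | .at p .wOut => if isLeafAt T p then .at p .leaf else .at p .wH
  | .at p .bOut => if isLeafAt T p then .at p .wOut else .at p .bw

/-- The colour of the source of a dart. The vertex of a leaf is black if the leaf is joined to its
parent by a horizontal edge, and white if it is joined by a vertical edge. -/
def rawColor {n : ℕ} (T : BinaryTree Unit) : RawDart n → Option Color
  | .bdry _ => none
  | .at p x =>
      if isLeafAt T p then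
        match p with
        | .V :: _ => some .white
        | _ => some .black
      else
        match x with
        | .wOut | .wb | .wH => some .white
        | _ => some .black

lemma subtreeAt_append (T : BinaryTree Unit) (q p : List Step) :
    subtreeAt T (q ++ p) = (subtreeAt T p).bind fun t => subtreeAt t q := by
  induction q with
  | nil => cases h : subtreeAt T p <;> simp [subtreeAt, h]
  | cons s q ih =>
    rw [List.cons_append, subtreeAt, ih]
    cases h : subtreeAt T p <;> simp [subtreeAt]

lemma mem_leavesFrom (T : BinaryTree Unit) (p x : List Step) :
    x ∈ leavesFrom T p ↔ ∃ q, x = q ++ p ∧ subtreeAt T q = some .nil := by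
  induction T generalizing p with
  | nil =>
    simp only [leavesFrom, List.mem_singleton]
    constructor
    · rintro rfl
      exact ⟨[], rfl, rfl⟩
    · rintro ⟨q, rfl, hq⟩
      rcases List.eq_nil_or_concat q with rfl | ⟨q', s, rfl⟩
      · rfl
      · rw [List.concat_eq_append, subtreeAt_append] at hq
        cases s <;> simp [subtreeAt, child] at hq
  | node a tH tV ihH ihV =>
    simp only [leavesFrom, List.mem_append, ihH, ihV]
    constructor
    · rintro (⟨q, rfl, hq⟩ | ⟨q, rfl, hq⟩)
      · exact ⟨q ++ [.H], by simp, by rw [subtreeAt_append]; simpa [subtreeAt, child] using hq⟩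
      · exact ⟨q ++ [.V], by simp, by rw [subtreeAt_append]; simpa [subtreeAt, child] using hq⟩
    · rintro ⟨q, rfl, hq⟩
      rcases List.eq_nil_or_concat q with rfl | ⟨q', s, rfl⟩
      · simp [subtreeAt] at hq
      · rw [List.concat_eq_append, subtreeAt_append] at hq
        cases s
        · exact .inl ⟨q', by simp, by simpa [subtreeAt, child] using hq⟩
        · exact .inr ⟨q', by simp, by simpa [subtreeAt, child] using hq⟩

lemma mem_leafList (T : BinaryTree Unit) (p : List Step) :
    p ∈ leafList T ↔ subtreeAt T p = some .nil := by
  simp [leafList, mem_leavesFrom]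

lemma length_leavesFrom (T : BinaryTree Unit) (p : List Step) :
    (leavesFrom T p).length = T.numLeaves := by
  induction T generalizing p with
  | nil => rfl
  | node a tH tV ihH ihV => simp [leavesFrom, ihH, ihV]

lemma length_leafList (T : BinaryTree Unit) : (leafList T).length = T.numLeaves :=
  length_leavesFrom T []

lemma nodup_leavesFrom (T : BinaryTree Unit) (p : List Step) : (leavesFrom T p).Nodup := by
  induction T generalizing p with
  | nil => simp [leavesFrom]
  | node a tH tV ihH ihV =>
    refine List.nodup_append'.2 ⟨ihH _, ihV _, fun x hx hx' => ?_⟩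
    obtain ⟨q, rfl, -⟩ := (mem_leavesFrom _ _ _).1 hx
    obtain ⟨q', h, -⟩ := (mem_leavesFrom _ _ _).1 hx'
    have h1 : (q ++ [Step.H]) ++ p = (q' ++ [Step.V]) ++ p := by simpa using h
    have h2 := List.append_cancel_right h1
    have h3 := congrArg List.getLast? h2
    simp at h3

lemma finite_addresses (T : BinaryTree Unit) : {p | subtreeAt T p ≠ none}.Finite := by
  induction T with
  | nil =>
    refine (Set.finite_singleton []).subset fun q hq => ?_
    rcases List.eq_nil_or_concat q with rfl | ⟨q', s, rfl⟩
    · rfl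
    · exfalso
      rw [Set.mem_ofPred_eq, List.concat_eq_append, subtreeAt_append] at hq
      cases s <;> simp [subtreeAt, child] at hq
  | node a tH tV ihH ihV =>
    refine ((Set.finite_singleton []).union
      ((ihH.image (· ++ [Step.H])).union (ihV.image (· ++ [Step.V])))).subset fun q hq => ?_
    rcases List.eq_nil_or_concat q with rfl | ⟨q', s, rfl⟩
    · exact .inl rfl
    · rw [Set.mem_ofPred_eq, List.concat_eq_append, subtreeAt_append] at hq
      cases s
      · exact .inr (.inl ⟨q', by simpa [subtreeAt, child] using hq, by simp⟩)
      · exact .inr (.inr ⟨q', by simpa [subtreeAt, child] using hq, by simp⟩)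

lemma ValidPort.ne_none {T : BinaryTree Unit} {p : List Step} {x : Port} (h : ValidPort T p x) :
    subtreeAt T p ≠ none := by
  intro h'
  simp [ValidPort, h'] at h

lemma validPort_out {T : BinaryTree Unit} {p : List Step} {x : Port}
    (hx : x = .wOut ∨ x = .bOut) : ValidPort T p x ↔ subtreeAt T p ≠ none := by
  refine ⟨ValidPort.ne_none, fun h => ?_⟩
  unfold ValidPort
  rcases hx with rfl | rfl <;> split <;> simp_all

lemma validPort_leaf {T : BinaryTree Unit} {p : List Step} :
    ValidPort T p .leaf ↔ subtreeAt T p = some .nil := by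
  unfold ValidPort
  split <;> simp_all

lemma validPort_inner {T : BinaryTree Unit} {p : List Step} {x : Port} (s : Step)
    (hx : x = .wb ∨ x = .bw ∨ x = .wH ∨ x = .bV) :
    ValidPort T p x ↔ subtreeAt T (s :: p) ≠ none := by
  unfold ValidPort
  simp only [subtreeAt]
  rcases h : subtreeAt T p with _ | _ | ⟨a, tH, tV⟩
  · simp
  · rcases hx with rfl | rfl | rfl | rfl <;> cases s <;> simp [child]
  · rcases hx with rfl | rfl | rfl | rfl <;> cases s <;> simp [child]

lemma subtreeAt_cons_ne_none {T : BinaryTree Unit} {p : List Step} (s s' : Step)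
    (h : subtreeAt T (s :: p) ≠ none) : subtreeAt T (s' :: p) ≠ none :=
  (validPort_inner (x := .wb) s' (.inl rfl)).1 ((validPort_inner s (.inl rfl)).2 h)

section

variable {n : ℕ} {T : BinaryTree Unit} (hn : T.numLeaves + 2 = n)

lemma rawRev_leaf {p : List Step} (hp : subtreeAt T p = some .nil) :
    ∃ h : (leafList T).idxOf p + 1 < n - 1,
      rawRev T hn (.at p .leaf) = .bdry ⟨(leafList T).idxOf p + 1, by omega⟩ := by
  have h1 : (leafList T).idxOf p < T.numLeaves := by
    rw [← length_leafList]
    exact List.idxOf_lt_length_iff.2 ((mem_leafList T p).2 hp)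
  refine ⟨by omega, ?_⟩
  rw [rawRev, dif_pos]

lemma rawRev_bdry {i : Fin n} (h0 : (i : ℕ) ≠ 0) (h1 : (i : ℕ) ≠ n - 1) :
    ∃ h : (i : ℕ) - 1 < (leafList T).length,
      rawRev T hn (.bdry i) = .at (leafList T)[(i : ℕ) - 1] .leaf := by
  have h2 : (i : ℕ) - 1 < (leafList T).length := by
    rw [length_leafList]
    have := i.2
    omega
  refine ⟨h2, ?_⟩
  rw [rawRev, if_neg h0, if_neg h1, List.getD_eq_getElem _ _ h2]

lemma rawRev_valid (d : RawDart n) (hd : ValidDart T d) : ValidDart T (rawRev T hn d) := by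
  rcases d with i | ⟨p, x⟩
  · by_cases h0 : (i : ℕ) = 0
    · rw [rawRev, if_pos h0]
      exact (validPort_out (.inl rfl)).2 (by simp [subtreeAt])
    · by_cases h1 : (i : ℕ) = n - 1
      · rw [rawRev, if_neg h0, if_pos h1]
        exact (validPort_out (.inr rfl)).2 (by simp [subtreeAt])
      · obtain ⟨h2, h3⟩ := rawRev_bdry hn h0 h1
        rw [h3]
        exact validPort_leaf.2 ((mem_leafList _ _).1 (List.getElem_mem _))
  · have hd' : ValidPort T p x := hd
    cases x with
    | wb =>
      rw [rawRev]
      exact (validPort_inner .H (by simp)).2 ((validPort_inner .H (by simp)).1 hd')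
    | bw =>
      rw [rawRev]
      exact (validPort_inner .H (by simp)).2 ((validPort_inner .H (by simp)).1 hd')
    | wH =>
      rw [rawRev]
      exact (validPort_out (by simp)).2 ((validPort_inner .H (by simp)).1 hd')
    | bV =>
      rw [rawRev]
      exact (validPort_out (by simp)).2 ((validPort_inner .V (by simp)).1 hd')
    | leaf =>
      obtain ⟨h, h'⟩ := rawRev_leaf hn (validPort_leaf.1 hd')
      rw [h']
      trivial
    | wOut =>
      rcases p with _ | ⟨_ | _, p⟩
      · rw [rawRev]
        trivial
      · rw [rawRev]
        exact (validPort_inner .H (by simp)).2 hd'.ne_none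
      · rw [rawRev]
        exact (validPort_out (by simp)).2 (subtreeAt_cons_ne_none .V .H hd'.ne_none)
    | bOut =>
      rcases p with _ | ⟨_ | _, p⟩
      · rw [rawRev]
        trivial
      · rw [rawRev]
        exact (validPort_out (by simp)).2 (subtreeAt_cons_ne_none .H .V hd'.ne_none)
      · rw [rawRev]
        exact (validPort_inner .V (by simp)).2 hd'.ne_none

lemma rawRev_rawRev (d : RawDart n) (hd : ValidDart T d) : rawRev T hn (rawRev T hn d) = d := by
  rcases d with i | ⟨p, x⟩
  · by_cases h0 : (i : ℕ) = 0
    · rw [rawRev, if_pos h0, rawRev]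
      congr 1
      exact Fin.ext h0.symm
    · by_cases h1 : (i : ℕ) = n - 1
      · rw [rawRev, if_neg h0, if_pos h1, rawRev]
        congr 1
        exact Fin.ext h1.symm
      · obtain ⟨h2, h3⟩ := rawRev_bdry hn h0 h1
        obtain ⟨h4, h5⟩ := rawRev_leaf hn ((mem_leafList _ _).1 (List.getElem_mem h2))
        rw [h3, h5]
        congr 1
        ext
        simp only [(nodup_leavesFrom T []).idxOf_getElem, leafList]
        omega
  · have hd' : ValidPort T p x := hd
    cases x with
    | leaf =>
      have hp := validPort_leaf.1 hd'
      obtain ⟨h, h'⟩ := rawRev_leaf hn hp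
      rw [h']
      obtain ⟨h2, h3⟩ := rawRev_bdry hn (i := ⟨(leafList T).idxOf p + 1, by omega⟩) (by simp)
        (by simp only; omega)
      rw [h3]
      simp
    | wOut => rcases p with _ | ⟨_ | _, p⟩ <;> simp [rawRev]
    | bOut =>
      rcases p with _ | ⟨_ | _, p⟩
      · have : n - 1 ≠ 0 := by omega
        simp [rawRev, this]
      · simp [rawRev]
      · simp [rawRev]
    | _ => simp [rawRev]

lemma rawRev_ne (d : RawDart n) (hd : ValidDart T d) : rawRev T hn d ≠ d := by
  rcases d with i | ⟨p, x⟩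
  · rw [rawRev]
    split
    · simp
    · split <;> simp
  · have hd' : ValidPort T p x := hd
    cases x with
    | leaf =>
      obtain ⟨h, h'⟩ := rawRev_leaf hn (validPort_leaf.1 hd')
      simp [h']
    | wOut => rcases p with _ | ⟨_ | _, p⟩ <;> simp [rawRev]
    | bOut => rcases p with _ | ⟨_ | _, p⟩ <;> simp [rawRev]
    | _ => simp [rawRev]

end

lemma rawCw_valid {n : ℕ} {T : BinaryTree Unit} (d : RawDart n) (hd : ValidDart T d) :
    ValidDart T (rawCw T d) := by
  rcases d with i | ⟨p, x⟩
  · trivial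
  · have hd' : ValidPort T p x := hd
    rcases h : subtreeAt T p with _ | _ | ⟨a, tH, tV⟩ <;>
      cases x <;> simp [ValidPort, h] at hd' <;>
      simp [rawCw, isLeafAt, h, ValidDart, ValidPort]

lemma rawCw_rawCw_rawCw {n : ℕ} {T : BinaryTree Unit} (d : RawDart n) (hd : ValidDart T d) :
    rawCw T (rawCw T (rawCw T d)) = d := by
  rcases d with i | ⟨p, x⟩
  · rfl
  · have hd' : ValidPort T p x := hd
    rcases h : subtreeAt T p with _ | _ | ⟨a, tH, tV⟩ <;>
      cases x <;> simp [ValidPort, h] at hd' <;>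
      simp [rawCw, isLeafAt, h]

lemma rawColor_rawCw {n : ℕ} {T : BinaryTree Unit} (d : RawDart n) (hd : ValidDart T d) :
    rawColor T (rawCw T d) = rawColor T d := by
  rcases d with i | ⟨p, x⟩
  · rfl
  · have hd' : ValidPort T p x := hd
    rcases h : subtreeAt T p with _ | _ | ⟨a, tH, tV⟩ <;>
      cases x <;> simp [ValidPort, h] at hd' <;>
      simp [rawCw, rawColor, isLeafAt, h]

lemma rawColor_at_ne_none {n : ℕ} {T : BinaryTree Unit} (p : List Step) (x : Port) :
    rawColor T (.at p x : RawDart n) ≠ none := by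
  unfold rawColor
  dsimp only
  split <;> split <;> simp

/-- The plabic graph `G(T)`. -/
def plabicGraph {n k : ℕ} (T : CompleteTree n k) : BicoloredMap n where
  Dart := {d : RawDart n // ValidDart T.tree d}
  finite_dart := by
    have h1 := (finite_addresses T.tree).to_subtype
    let f : {d : RawDart n // ValidDart T.tree d} →
        Fin n ⊕ ({p | subtreeAt T.tree p ≠ none} × Port) := fun d =>
      match d with
      | ⟨.bdry i, _⟩ => .inl i
      | ⟨.at p x, h⟩ => .inr (⟨p, ValidPort.ne_none h⟩, x)
    refine Finite.of_injective f ?_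
    rintro ⟨i | ⟨p, x⟩, h⟩ ⟨i' | ⟨p', x'⟩, h'⟩ he <;> simp_all [f]
  rev d := ⟨rawRev T.tree T.leaves d, rawRev_valid T.leaves d.1 d.2⟩
  rev_rev d := Subtype.ext (rawRev_rawRev T.leaves d.1 d.2)
  rev_ne d h := rawRev_ne T.leaves d.1 d.2 (congrArg Subtype.val h)
  cw :=
    { toFun := fun d => ⟨rawCw T.tree d, rawCw_valid d.1 d.2⟩
      invFun := fun d => ⟨rawCw T.tree (rawCw T.tree d), rawCw_valid _ (rawCw_valid d.1 d.2)⟩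
      left_inv := fun d => Subtype.ext (rawCw_rawCw_rawCw d.1 d.2)
      right_inv := fun d => Subtype.ext (rawCw_rawCw_rawCw d.1 d.2) }
  color d := rawColor T.tree d.1
  color_cw d := rawColor_rawCw d.1 d.2
  bdry i := ⟨.bdry i, trivial⟩
  bdry_injective i j h := RawDart.bdry.inj (congrArg Subtype.val h)
  cw_bdry i := rfl
  color_eq_none d := by
    rcases d with ⟨i | ⟨p, x⟩, h⟩
    · exact ⟨fun _ => ⟨i, rfl⟩, fun _ => rfl⟩
    · refine ⟨fun h' => absurd h' (rawColor_at_ne_none p x), ?_⟩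
      rintro ⟨i, hi⟩
      have h2 : (RawDart.at p x : RawDart n) = .bdry i :=
        congrArg (fun d : {d : RawDart n // ValidDart T.tree d} => d.1) hi
      simp at h2

/-! ## Lattice paths -/

/-- `ℒ_{n,k,4}`: pairs of noncrossing lattice paths from the northeast corner to the southwest
corner of a `k × (n - k - 4)` rectangle, written as words in `H` (a step west) and `V`
(a step south); the lower path is weakly below the upper path. -/
structure PathPair (n k : ℕ) where
  upper : List Step
  lower : List Step
  length_upper : upper.length + 4 = n
  length_lower : lower.length + 4 = n
  count_upper : upper.count .V = k
  count_lower : lower.count .V = k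
  noncrossing : ∀ i, (upper.take i).count .V ≤ (lower.take i).count .V

/-- The word of the upper path of a tree (with an irrelevant value on `nil`). -/
def upperWord : BinaryTree Unit → List Step
  | .nil => []
  | .node _ .nil .nil => []
  | .node _ (.node a x y) .nil => .H :: upperWord (.node a x y)
  | .node _ .nil (.node b z w) => .V :: upperWord (.node b z w)
  | .node _ (.node a x y) (.node b z w) =>
      (.H :: upperWord (.node a x y)) ++ (.V :: upperWord (.node b z w))

/-- The word of the lower path of a tree (with an irrelevant value on `nil`). -/
def lowerWord : BinaryTree Unit → List Step
  | .nil => []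
  | .node _ .nil .nil => []
  | .node _ (.node a x y) .nil => lowerWord (.node a x y) ++ [.H]
  | .node _ .nil (.node b z w) => .V :: lowerWord (.node b z w)
  | .node _ (.node a x y) (.node b z w) =>
      (lowerWord (.node a x y) ++ [.H]) ++ (.V :: lowerWord (.node b z w))

/-- The row lengths, from top to bottom, of the Young diagram whose southeast border is the lattice
path `w`: the length of a row is the number of steps west after its vertical step. -/
def pathRowLens : List Step → List ℕ
  | [] => []
  | .H :: w => pathRowLens w
  | .V :: w => w.count .H :: pathRowLens w

lemma pathRowLens_le (w : List Step) : ∀ a ∈ pathRowLens w, a ≤ w.count .H := by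
  induction w with
  | nil => simp [pathRowLens]
  | cons s w ih =>
    cases s with
    | H => exact fun a ha => (ih a ha).trans (by simp)
    | V =>
      intro a ha
      rcases List.mem_cons.1 ha with rfl | ha
      · simp
      · simpa using ih a ha

lemma pathRowLens_sorted (m : ℕ) (w : List Step) :
    ((pathRowLens w).map (· + m)).SortedGE := by
  rw [List.sortedGE_iff_pairwise, List.pairwise_map]
  induction w with
  | nil => simp [pathRowLens]
  | cons s w ih =>
    cases s with
    | H => exact ih
    | V =>
      refine List.pairwise_cons.2 ⟨fun a ha => ?_, ih⟩
      have := pathRowLens_le w a ha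
      simp only [ge_iff_le]
      omega

lemma length_pathRowLens (w : List Step) : (pathRowLens w).length = w.count .V := by
  induction w with
  | nil => simp [pathRowLens]
  | cons s w ih => cases s <;> simp [pathRowLens, ih]

/-- The Young diagram whose southeast border is the path `w`, with `m` extra columns, whose height
is the number of vertical steps of `w`, added at the left. -/
def pathDiagram (m : ℕ) (w : List Step) : YoungDiagram :=
  YoungDiagram.ofRowLens ((pathRowLens w).map (· + m)) (pathRowLens_sorted m w)

/-! ## From pairs of paths to `⊕`-diagrams -/

/-- Given the set `E` of empty boxes, place a top-justified column of `i` zeros as far to the right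
as possible: all of `(0, c), …, (i - 1, c)` must be empty, and `c` is maximal with this property.
The result is the set of boxes that are still empty. -/
def placeColumn (n : ℕ) (E : Finset (ℕ × ℕ)) (i : ℕ) : Finset (ℕ × ℕ) :=
  match ((Finset.range n).filter fun c => ∀ r < i, (r, c) ∈ E).max with
  | none => E
  | some c => E.filter fun x => ¬ (x.2 = c ∧ x.1 < i)

namespace PathPair

variable {n k : ℕ} (W : PathPair n k)

/-- Step 1: the shape of the diagram. -/
def shape : YoungDiagram := pathDiagram 4 W.lower

/-- Step 1: the boxes at the far left and at the far right of a row, which are filled with `+`. -/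
def endBoxes : Finset (ℕ × ℕ) :=
  W.shape.cells.filter fun x => x.2 = 0 ∨ x.2 + 1 = W.shape.rowLen x.1

/-- Step 2: the boxes that are empty after the columns of the Young diagram above the upper path
have been placed as columns of zeros, from left to right. -/
def emptyBoxes : Finset (ℕ × ℕ) :=
  ((List.range (n - k - 4)).map (pathDiagram 0 W.upper).colLen).foldl (placeColumn n)
    (W.shape.cells \ W.endBoxes)

/-- Step 3: the two rightmost empty boxes of each row, which are filled with `+`. -/
def innerBoxes : Finset (ℕ × ℕ) :=
  W.emptyBoxes.filter fun x =>
    (W.emptyBoxes.filter fun y => y.1 = x.1 ∧ x.2 < y.2).card < 2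

/-- The boxes filled with `+`; Step 4 fills all the others with `0`. -/
def plusBoxes : Finset (ℕ × ℕ) := W.endBoxes ∪ W.innerBoxes

end PathPair

/-! ## The two maps -/

lemma length_words (T : BinaryTree Unit) (hT : T ≠ .nil) :
    (upperWord T).length + 2 = T.numLeaves ∧ (lowerWord T).length + 2 = T.numLeaves := by
  fun_induction upperWord T with
  | case1 => exact absurd rfl hT
  | case2 => simp [lowerWord]
  | case3 _ a x y ih =>
    have := ih (by simp)
    simp only [lowerWord, List.length_cons, List.length_append, List.length_nil,
      BinaryTree.numLeaves] at this ⊢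
    omega
  | case4 _ a x y ih =>
    have := ih (by simp)
    simp only [lowerWord, List.length_cons, BinaryTree.numLeaves] at this ⊢
    omega
  | case5 _ a x y b z w ih1 ih2 =>
    have h1 := ih1 (by simp)
    have h2 := ih2 (by simp)
    simp only [lowerWord, List.length_cons, List.length_append, List.length_nil,
      BinaryTree.numLeaves] at h1 h2 ⊢
    omega

lemma count_words (T : BinaryTree Unit) (hT : T ≠ .nil) :
    (upperWord T).count .V + 1 = horizontalLeaves T ∧
      (lowerWord T).count .V + 1 = horizontalLeaves T := by
  fun_induction upperWord T with
  | case1 => exact absurd rfl hT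
  | case2 => simp [lowerWord, horizontalLeaves]
  | case3 _ a x y ih =>
    have := ih (by simp)
    simp [lowerWord, horizontalLeaves]
    omega
  | case4 _ a x y ih =>
    have := ih (by simp)
    simp [lowerWord, horizontalLeaves]
    omega
  | case5 _ a x y b z w ih1 ih2 =>
    have h1 := ih1 (by simp)
    have h2 := ih2 (by simp)
    simp [lowerWord, horizontalLeaves]
    omega

lemma count_take_H_cons {u l : List Step}
    (h : ∀ i, (u.take i).count .V ≤ (l.take i).count .V) (i : ℕ) :
    ((Step.H :: u).take i).count .V ≤ ((l ++ [Step.H]).take i).count .V := by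
  rcases i with _ | i
  · simp
  · refine le_trans (by simpa using h i) ?_
    have h1 : (l.take i).Sublist ((l ++ [Step.H]).take (i + 1)) := by
      rw [List.take_append]
      exact (List.take_sublist_take_left (Nat.le_succ i)).trans (List.sublist_append_left _ _)
    exact h1.count_le _

lemma count_take_append {u l u' l' : List Step} (hl : u.length = l.length)
    (h : ∀ i, (u.take i).count .V ≤ (l.take i).count .V)
    (h' : ∀ i, (u'.take i).count .V ≤ (l'.take i).count .V) (i : ℕ) :
    ((u ++ u').take i).count .V ≤ ((l ++ l').take i).count .V := by
  rw [List.take_append, List.take_append, List.count_append, List.count_append, hl]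
  exact add_le_add (h i) (h' _)

lemma count_take_V_cons {u l : List Step}
    (h : ∀ i, (u.take i).count .V ≤ (l.take i).count .V) (i : ℕ) :
    ((Step.V :: u).take i).count .V ≤ ((Step.V :: l).take i).count .V := by
  rcases i with _ | i
  · simp
  · simpa using h i

lemma noncrossing_words (T : BinaryTree Unit) (i : ℕ) :
    ((upperWord T).take i).count .V ≤ ((lowerWord T).take i).count .V := by
  fun_induction upperWord T generalizing i with
  | case1 => simp
  | case2 => simp
  | case3 _ a x y ih =>
    rw [lowerWord]
    exact count_take_H_cons ih i
  | case4 _ a x y ih =>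
    rw [lowerWord]
    exact count_take_V_cons ih i
  | case5 _ a x y b z w ih1 ih2 =>
    rw [lowerWord]
    refine count_take_append ?_ (count_take_H_cons ih1) (count_take_V_cons ih2) i
    have := length_words (.node a x y) (by simp)
    simp only [List.length_cons, List.length_append, List.length_nil]
    omega

/-- The map `Ω_{𝒯ℒ}` from trees to pairs of noncrossing lattice paths. -/
def omegaTL {n k : ℕ} (T : CompleteTree n k) : PathPair n k where
  upper := upperWord T.tree
  lower := lowerWord T.tree
  length_upper := by
    have := length_words T.tree T.ne_nil
    have := T.leaves
    omega
  length_lower := by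
    have := length_words T.tree T.ne_nil
    have := T.leaves
    omega
  count_upper := by
    have := count_words T.tree T.ne_nil
    have := T.horizontal
    omega
  count_lower := by
    have := count_words T.tree T.ne_nil
    have := T.horizontal
    omega
  noncrossing := noncrossing_words T.tree

lemma placeColumn_subset (n : ℕ) (E : Finset (ℕ × ℕ)) (i : ℕ) : placeColumn n E i ⊆ E := by
  unfold placeColumn
  split
  · exact subset_rfl
  · exact Finset.filter_subset _ _

lemma foldl_placeColumn_subset (n : ℕ) (l : List ℕ) (E : Finset (ℕ × ℕ)) :
    l.foldl (placeColumn n) E ⊆ E := by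
  induction l generalizing E with
  | nil => exact subset_rfl
  | cons i l ih => exact (ih _).trans (placeColumn_subset n E i)

lemma PathPair.count_H_lower {n k : ℕ} (W : PathPair n k) :
    W.lower.count .H + k + 4 = n := by
  have h1 := W.length_lower
  have h2 := W.count_lower
  have h3 : ∀ l : List Step, l.count .H + l.count .V = l.length := by
    intro l
    induction l with
    | nil => rfl
    | cons s l ih => cases s <;> simp <;> omega
  have := h3 W.lower
  omega

/-- The map `Ω_{ℒ𝒟}` from pairs of noncrossing lattice paths to `⊕`-diagrams. -/
def omegaLD {n k : ℕ} (W : PathPair n k) : OplusDiagram k n where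
  shape := W.shape
  k_le := by
    have := W.count_H_lower
    omega
  fits := by
    rintro ⟨r, c⟩ hx
    obtain ⟨h1, h2⟩ := (YoungDiagram.mem_ofRowLens (hw := pathRowLens_sorted 4 W.lower)).1 hx
    simp only [List.length_map, length_pathRowLens, W.count_lower, List.getElem_map] at h1 h2
    have h3 := pathRowLens_le W.lower _ (List.getElem_mem (l := pathRowLens W.lower) (n := r)
      (by rw [length_pathRowLens, W.count_lower]; exact h1))
    have := W.count_H_lower
    refine ⟨h1, ?_⟩
    simp only
    omega
  plus := W.plusBoxes
  plus_subset := by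
    intro x hx
    rw [← YoungDiagram.mem_cells]
    rcases Finset.mem_union.1 hx with h | h
    · exact (Finset.mem_filter.1 h).1
    · exact (Finset.mem_sdiff.1
        (foldl_placeColumn_subset _ _ _ (Finset.mem_filter.1 h).1)).1

end BCFW

/-! Both permutations are computed by recursion on the tree, and the two recursions agree.

Diagram side. Every row contains exactly four `+`: in column 0, in its last column z, and in two
inner columns x > y. A pipe that meets a `+` of the row from below moves to the next `+` on its
left. Hence crossing the row acts on labels as the five-cycle a ↦ z ↦ x ↦ y ↦ N ↦ a, where a is the
row label, N the label of column 0, and a column stands for its label. So π_D is the product of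
these cycles, the bottom row acting first (`OplusDiagram.pipe_eq_rowsMap`).

The inner columns are found with a stack. Read both words from right to left: an `H` of the lower
word makes one more column interior to all higher rows (push), and an `H` of the upper word fills
the rightmost available column with zeros (pop); see `PathRun.spec`. The two letters `H` that belong
to an internal horizontal child enclose the words of its subtree, so reading a subtree restores the
stack (`PathRun.tree`). This gives the recursion `rowsOf`: each internal vertical child contributes
a row and inherits the top columns (x, y), while a horizontal child receives (z, x).

Graph side. A subtree with leaves s, …, s + l + 1 has l + 4 gates: its leaves, its white end and its
black end. They get source and target labels among s, …, s + l, X, Y, N. The product of the cycles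
of the subtree sends the source of each gate to the target of the gate where its trip leaves
(`TripSpec`, `tripSpec_tree`). At a vertex with two internal children this product is DH ∘ cycle ∘
DV, and the five arrows of the cycle translate between the labellings of the children and of the
vertex (`tripSpec_node_node`).

At the root, X, Y, N are n - 3, n - 2, n - 1 (zero-based), the source of a gate is its boundary
vertex, and its target is the image of that vertex under c_n². No fixed point is white, because the
`+` at the right end of a row turns the pipe north out of that row. -/

namespace BCFW

/-! ## Trips through a subtree -/

/-- `Go T hn a l`: a trip that arrives at an internal vertex through the edge of the dart `a` at
that vertex leaves, after some passages through internal vertices, along the dart `l`. -/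
inductive Go {n : ℕ} (T : BinaryTree Unit) (hn : T.numLeaves + 2 = n) :
    RawDart n → RawDart n → Prop
  | white {a} : rawColor T a = some .white → Go T hn a (rawCw T a)
  | black {a} : rawColor T a = some .black → Go T hn a (rawCw T (rawCw T a))
  | trans {a l l'} : Go T hn a l → Go T hn (rawRev T hn l) l' → Go T hn a l'

section

variable {n : ℕ} {T : BinaryTree Unit} (hn : T.numLeaves + 2 = n)

section Leaf

variable {p : List Step}

lemma isLeafAt_of_nil (hp : subtreeAt T p = some .nil) : isLeafAt T p = true := by
  simp [isLeafAt, hp]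

lemma isLeafAt_of_node {u : Unit} {tH tV : BinaryTree Unit}
    (hp : subtreeAt T p = some (.node u tH tV)) : isLeafAt T p = false := by
  simp [isLeafAt, hp]

/-- The clockwise order at a leaf vertex is `leaf`, `bOut`, `wOut`. A trip steps backwards in it at
a black (horizontal) leaf and forwards at a white (vertical) one; this and the next five lemmas list
the cases. -/
lemma go_leafH_wOut (hp : subtreeAt T (.H :: p) = some .nil) :
    Go T hn (.at (.H :: p) .wOut) (.at (.H :: p) .bOut) := by
  have h := Go.black (hn := hn) (a := .at (.H :: p) .wOut)
    (by simp [rawColor, isLeafAt_of_nil hp])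
  simpa [rawCw, isLeafAt_of_nil hp] using h

lemma go_leafH_bOut (hp : subtreeAt T (.H :: p) = some .nil) :
    Go T hn (.at (.H :: p) .bOut) (.at (.H :: p) .leaf) := by
  have h := Go.black (hn := hn) (a := .at (.H :: p) .bOut)
    (by simp [rawColor, isLeafAt_of_nil hp])
  simpa [rawCw, isLeafAt_of_nil hp] using h

lemma go_leafH_leaf (hp : subtreeAt T (.H :: p) = some .nil) :
    Go T hn (.at (.H :: p) .leaf) (.at (.H :: p) .wOut) := by
  have h := Go.black (hn := hn) (a := .at (.H :: p) .leaf)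
    (by simp [rawColor, isLeafAt_of_nil hp])
  simpa [rawCw, isLeafAt_of_nil hp] using h

lemma go_leafV_wOut (hp : subtreeAt T (.V :: p) = some .nil) :
    Go T hn (.at (.V :: p) .wOut) (.at (.V :: p) .leaf) := by
  have h := Go.white (hn := hn) (a := .at (.V :: p) .wOut)
    (by simp [rawColor, isLeafAt_of_nil hp])
  simpa [rawCw, isLeafAt_of_nil hp] using h

lemma go_leafV_bOut (hp : subtreeAt T (.V :: p) = some .nil) :
    Go T hn (.at (.V :: p) .bOut) (.at (.V :: p) .wOut) := by
  have h := Go.white (hn := hn) (a := .at (.V :: p) .bOut)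
    (by simp [rawColor, isLeafAt_of_nil hp])
  simpa [rawCw, isLeafAt_of_nil hp] using h

lemma go_leafV_leaf (hp : subtreeAt T (.V :: p) = some .nil) :
    Go T hn (.at (.V :: p) .leaf) (.at (.V :: p) .bOut) := by
  have h := Go.white (hn := hn) (a := .at (.V :: p) .leaf)
    (by simp [rawColor, isLeafAt_of_nil hp])
  simpa [rawCw, isLeafAt_of_nil hp] using h

end Leaf

section Node

variable {p : List Step} {u : Unit} {tH tV : BinaryTree Unit}
  (hp : subtreeAt T p = some (.node u tH tV))

include hp

/-- A trip that enters at `w_p` continues into the horizontal child. -/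
lemma go_wOut_trans {l : RawDart n} (h : Go T hn (.at (.H :: p) .wOut) l) :
    Go T hn (.at p .wOut) l := by
  have h1 := Go.white (hn := hn) (a := .at p .wOut)
    (by simp [rawColor, isLeafAt_of_node hp])
  rw [rawCw, if_neg (by simp [isLeafAt_of_node hp])] at h1
  exact h1.trans (by rwa [rawRev])

/-- A trip that enters at `b_p` continues into the vertical child. -/
lemma go_bOut_trans {l : RawDart n} (h : Go T hn (.at (.V :: p) .bOut) l) :
    Go T hn (.at p .bOut) l := by
  have h1 := Go.black (hn := hn) (a := .at p .bOut)
    (by simp [rawColor, isLeafAt_of_node hp])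
  rw [rawCw, if_neg (by simp [isLeafAt_of_node hp]), rawCw] at h1
  exact h1.trans (by rwa [rawRev])

/-- A trip that leaves the horizontal child at its white end leaves at `b_p`. -/
lemma go_H_wOut {a : RawDart n} (h : Go T hn a (.at (.H :: p) .wOut)) :
    Go T hn a (.at p .bOut) := by
  have h1 := Go.white (hn := hn) (a := .at p .wH)
    (by simp [rawColor, isLeafAt_of_node hp])
  have h2 := Go.black (hn := hn) (a := .at p .bw)
    (by simp [rawColor, isLeafAt_of_node hp])
  rw [rawCw] at h1
  rw [rawCw, rawCw] at h2
  refine h.trans ?_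
  rw [rawRev]
  refine h1.trans ?_
  rwa [rawRev]

/-- A trip that leaves the vertical child at its black end leaves at `w_p`. -/
lemma go_V_bOut {a : RawDart n} (h : Go T hn a (.at (.V :: p) .bOut)) :
    Go T hn a (.at p .wOut) := by
  have h1 := Go.black (hn := hn) (a := .at p .bV)
    (by simp [rawColor, isLeafAt_of_node hp])
  have h2 := Go.white (hn := hn) (a := .at p .wb)
    (by simp [rawColor, isLeafAt_of_node hp])
  rw [rawCw, rawCw, if_neg (by simp [isLeafAt_of_node hp])] at h1
  rw [rawCw] at h2
  refine h.trans ?_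
  rw [rawRev]
  refine h1.trans ?_
  rwa [rawRev]

end Node

/-- A trip that leaves the horizontal child at its black end enters the vertical child. -/
lemma go_H_bOut {p : List Step} {a l : RawDart n} (h : Go T hn a (.at (.H :: p) .bOut))
    (h' : Go T hn (.at (.V :: p) .wOut) l) : Go T hn a l :=
  h.trans (by rwa [rawRev])

/-- A trip that leaves the vertical child at its white end enters the horizontal child. -/
lemma go_V_wOut {p : List Step} {a l : RawDart n} (h : Go T hn a (.at (.V :: p) .wOut))
    (h' : Go T hn (.at (.H :: p) .bOut) l) : Go T hn a l :=
  h.trans (by rwa [rawRev])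

end

/-! ### From local moves to the trip permutation -/

lemma BicoloredMap.tripEnd_eq {n : ℕ} (G : BicoloredMap n) {i j : Fin n} {m : ℕ}
    (hm : G.step^[m] (G.bdry i) = G.rev (G.bdry j))
    (h : ∀ t < m, G.color (G.rev (G.step^[t] (G.bdry i))) ≠ none) : G.tripEnd i = j := by
  have h1 : G.tripLength i = m := by
    classical
    refine le_antisymm (Nat.find_min' _ ⟨j, hm⟩) ?_
    by_contra! hlt
    obtain ⟨j', hj'⟩ := G.tripLength_spec i
    refine h _ hlt ?_
    rw [hj', G.rev_rev]
    exact (G.color_eq_none _).2 ⟨j', rfl⟩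
  have h2 := G.tripEnd_spec i
  rw [h1, hm] at h2
  exact (G.bdry_injective (G.rev_injective h2)).symm

/-- Each base case of `Go` is one `step` at a vertex with a colour, and `trans` concatenates. So no
boundary vertex is met on the way, as is needed to recognise the first arrival at the boundary. -/
lemma Go.exists_iterate {n k : ℕ} (T : CompleteTree n k) {a l : RawDart n}
    (h : Go T.tree T.leaves a l) (ha : ValidDart T.tree a) (d : (plabicGraph T).Dart)
    (hd : (plabicGraph T).rev d = ⟨a, ha⟩) :
    ∃ m, (∃ hl, (plabicGraph T).step^[m] d = ⟨l, hl⟩) ∧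
      ∀ t < m, (plabicGraph T).color ((plabicGraph T).rev ((plabicGraph T).step^[t] d)) ≠ none := by
  induction h generalizing d with
  | @white a hc =>
    have hc' : (plabicGraph T).color ((plabicGraph T).rev d) = some .white := by rw [hd]; exact hc
    refine ⟨1, ⟨rawCw_valid _ ha, ?_⟩, fun t ht => ?_⟩
    · rw [Function.iterate_one, BicoloredMap.step, hc', hd]
      rfl
    · obtain rfl : t = 0 := by omega
      simp [hc']
  | @black a hc =>
    have hc' : (plabicGraph T).color ((plabicGraph T).rev d) = some .black := by rw [hd]; exact hc
    -- `rawCw` has order three on valid darts, so applying it twice is the counterclockwise turn.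
    refine ⟨1, ⟨rawCw_valid _ (rawCw_valid _ ha), ?_⟩, fun t ht => ?_⟩
    · rw [Function.iterate_one, BicoloredMap.step, hc', hd]
      rfl
    · obtain rfl : t = 0 := by omega
      simp [hc']
  | @trans a l l' h1 h2 ih1 ih2 =>
    obtain ⟨m1, ⟨hl, e1⟩, g1⟩ := ih1 ha d hd
    obtain ⟨m2, ⟨hl', e2⟩, g2⟩ := ih2 (rawRev_valid _ _ hl) ⟨l, hl⟩ rfl
    refine ⟨m2 + m1, ⟨hl', by rw [Function.iterate_add_apply, e1, e2]⟩, fun t ht => ?_⟩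
    rcases lt_or_ge t m1 with h | h
    · exact g1 t h
    · have := g2 (t - m1) (by omega)
      rwa [← e1, ← Function.iterate_add_apply, Nat.sub_add_cancel h] at this

lemma Go.tripEnd_eq {n k : ℕ} (T : CompleteTree n k) {i j : Fin n}
    (h : Go T.tree T.leaves (rawRev T.tree T.leaves (.bdry i))
      (rawRev T.tree T.leaves (.bdry j))) : (plabicGraph T).tripEnd i = j := by
  obtain ⟨m, ⟨hl, e⟩, g⟩ := h.exists_iterate T (rawRev_valid _ _ trivial)
    ((plabicGraph T).bdry i) rfl
  exact (plabicGraph T).tripEnd_eq (m := m) (e.trans (Subtype.ext rfl)) g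

/-! ## Reading a pair of paths with a stack -/

lemma count_H_add_count_V (w : List Step) : w.count .H + w.count .V = w.length := by
  induction w with
  | nil => rfl
  | cons a w ih => cases a <;> simp <;> omega

/-- The pair of words `L`, `U` is read from right to left, block by block, a block being delimited
by letters `V`, which are read simultaneously in both words. An `H` of `L` pushes the number of
the next column, where columns are numbered from the right end of `L` on, starting with `f`, and
afterwards an `H` of `U` pops. Each pair of letters `V` records a row: its position in `L`, where
`s` is the position of the first letter of `L`, the number of the next column, and the two topmost
elements of the stack. `PathRun f s L U S R S'` says that the stack `S` becomes `S'` and the rows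
`R` are recorded. -/
inductive PathRun (f : ℕ) :
    ℕ → List Step → List Step → List ℕ → List (ℕ × ℕ × ℕ × ℕ) → List ℕ → Prop
  | nil (s S) : PathRun f s [] [] S [] S
  | push {s L U S R S'} : PathRun f (s + 1) L U S R S' → U.head? ≠ some .H →
      PathRun f s (.H :: L) U S R ((f + L.count .H) :: S')
  | pop {s L U S R c S'} : PathRun f s L U S R (c :: S') → PathRun f s L (.H :: U) S R S'
  | sync {s L U S R x y S'} : PathRun f (s + 1) L U S R (x :: y :: S') →
      PathRun f s (.V :: L) (.V :: U) S ((s, f + L.count .H, x, y) :: R) (x :: y :: S')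

/-- The letters already read influence the rest only through the stack and the number of columns
passed, hence the shift of `f`. The condition on `U₂` keeps pushes legal when nothing of `U₁` has
been read yet. -/
lemma PathRun.append {f s₁ s₂ : ℕ} {L₁ U₁ L₂ U₂ : List Step} {S S₁ S₂ : List ℕ}
    {R₁ R₂ : List (ℕ × ℕ × ℕ × ℕ)} (h₂ : PathRun f s₂ L₂ U₂ S R₂ S₁) (hU : U₂.head? ≠ some .H)
    (h₁ : PathRun (f + L₂.count .H) s₁ L₁ U₁ S₁ R₁ S₂) (hs : s₂ = s₁ + L₁.length) :
    PathRun f s₁ (L₁ ++ L₂) (U₁ ++ U₂) S (R₁ ++ R₂) S₂ := by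
  induction h₁ with
  | nil s S => simpa [hs] using h₂
  | @push s L U S R S' h hh ih =>
    have h3 := (ih h₂ (by simp at hs; omega)).push (s := s) (by cases U <;> simp_all)
    rw [List.count_append, add_comm (L.count _), ← add_assoc] at h3
    exact h3
  | pop h ih => exact (ih h₂ hs).pop
  | @sync s L U S R x y S' h ih =>
    have h3 := (ih h₂ (by simp at hs; omega)).sync (s := s)
    rw [List.count_append, add_comm (L.count _), ← add_assoc] at h3
    exact h3

/-- The rows recorded when the words of the tree are read, if `x` and `y` are on top of the stack
at the beginning. -/
def rowsOf : BinaryTree Unit → ℕ → ℕ → ℕ → ℕ → List (ℕ × ℕ × ℕ × ℕ)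
  | .nil, _, _, _, _ => []
  | .node _ .nil .nil, _, _, _, _ => []
  | .node _ (.node a t t') .nil, s, f, x, _ => rowsOf (.node a t t') s (f + 1) f x
  | .node _ .nil (.node b z w), s, f, x, y =>
      (s, f + (lowerWord (.node b z w)).count .H, x, y) :: rowsOf (.node b z w) (s + 1) f x y
  | .node _ (.node a t t') (.node b z w), s, f, x, y =>
      rowsOf (.node a t t') s (f + (lowerWord (.node b z w)).count .H + 1)
          (f + (lowerWord (.node b z w)).count .H) x ++
        (s + (lowerWord (.node a t t')).length + 1,
          f + (lowerWord (.node b z w)).count .H, x, y) ::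
        rowsOf (.node b z w) (s + (lowerWord (.node a t t')).length + 2) f x y

/-- For an internal horizontal child, the `H` after its lower word pushes and the `H` before its
upper word pops the same column. These act as matching brackets, so the stack is restored. -/
lemma PathRun.tree (T : BinaryTree Unit) (s f x y : ℕ) (S : List ℕ) :
    PathRun f s (lowerWord T) (upperWord T) (x :: y :: S) (rowsOf T s f x y) (x :: y :: S) := by
  fun_induction rowsOf T s f x y generalizing S with
  | case1 => exact .nil _ _
  | case2 => exact .nil _ _
  | case3 _ a t t' s f x y ih =>
    -- The last `H` of the lower word is read first and pushes `f`. The horizontal subtree then sees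
    -- `f`, `x` on top, and `y` sinks into the rest of the stack.
    have h1 : PathRun f (s + (lowerWord (.node a t t')).length) [.H] [] (x :: y :: S) []
        (f :: x :: y :: S) := (PathRun.nil _ _).push (by simp)
    have h2 := h1.append (by simp) (ih (y :: S)) rfl
    simp only [List.append_nil] at h2
    exact h2.pop
  | case4 _ b z w s f x y ih => exact (ih S).sync
  | case5 _ a t t' b z w s f x y ih1 ih2 =>
    -- The column pushed here is the one just recorded as the last column of the row.
    have h1 := ((ih2 S).sync).push (s := s + (lowerWord (.node a t t')).length) (by simp)
    have e1 : (Step.V :: lowerWord (.node b z w)).count .H = (lowerWord (.node b z w)).count .H :=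
      List.count_cons_of_ne (by decide)
    have e2 := ih1 (y :: S)
    rw [add_assoc f, ← e1, ← List.count_cons_self] at e2
    have h2 := h1.append (by simp) e2 rfl
    rw [List.count_cons_self, e1, ← add_assoc] at h2
    rw [upperWord, lowerWord, List.cons_append, List.append_assoc]
    exact h2.pop

/-! ## The greedy placement of columns -/

/-- The heights of the columns to the north of a path with word `U`, from left to right, when `i`
is added to all of them. -/
def heights : ℕ → List Step → List ℕ
  | _, [] => []
  | i, .H :: U => heights i U ++ [i]
  | i, .V :: U => heights (i + 1) U

/-- A leading `H` adds a column at the right that no later row reaches; a leading `V` adds a row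
that meets every column. -/
lemma heights_eq (i : ℕ) (U : List Step) : heights i U =
    (List.range (U.count .H)).map fun c => i + ((pathRowLens U).filter (c < ·)).length := by
  induction U generalizing i with
  | nil => simp [heights]
  | cons a U ih =>
    cases a with
    | H =>
      rw [heights, ih, List.count_cons_self, List.range_succ, List.map_append]
      congr 1
      simp only [List.map_cons, List.map_nil, pathRowLens]
      rw [List.filter_eq_nil_iff.2]
      · simp
      · intro b hb
        simpa using pathRowLens_le U b hb
    | V =>
      rw [heights, ih]
      simp only [pathRowLens]
      rw [List.count_cons_of_ne (by decide)]
      refine List.map_congr_left fun c hc => ?_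
      rw [List.filter_cons_of_pos (by simpa using hc), List.length_cons]
      omega

lemma lt_length_filter_iff {w : List ℕ} (hw : w.Pairwise (· ≥ ·)) (c r : ℕ) :
    r < (w.filter (c < ·)).length ↔ ∃ v, w[r]? = some v ∧ c < v := by
  induction w generalizing r with
  | nil => simp
  | cons a w ih =>
    obtain ⟨h1, h2⟩ := List.pairwise_cons.1 hw
    by_cases ha : c < a
    · rw [List.filter_cons_of_pos (by simpa using ha)]
      cases r with
      | zero => simpa using ha
      | succ r => simpa using ih h2 r
    · have : w.filter (c < ·) = [] := by
        rw [List.filter_eq_nil_iff]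
        intro b hb
        have := h1 b hb
        simp
        omega
      rw [List.filter_cons_of_neg (by simpa using ha), this]
      cases r with
      | zero => simpa using ha
      | succ r =>
        simp only [List.length_nil, not_lt_zero, List.getElem?_cons_succ, false_iff, not_exists,
          not_and, not_lt]
        intro v hv
        have := h1 v (List.mem_of_getElem? hv)
        omega

lemma mem_pathDiagram {m : ℕ} {w : List Step} {r c : ℕ} :
    (r, c) ∈ pathDiagram m w ↔ ∃ v, (pathRowLens w)[r]? = some v ∧ c < v + m := by
  rw [pathDiagram, YoungDiagram.mem_ofRowLens]
  simp [List.getElem?_eq_some_iff]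

lemma rowLen_pathDiagram {m : ℕ} {w : List Step} {r v : ℕ} (h : (pathRowLens w)[r]? = some v) :
    (pathDiagram m w).rowLen r = v + m := by
  refine eq_of_forall_lt_iff fun c => ?_
  rw [← YoungDiagram.mem_iff_lt_rowLen, mem_pathDiagram]
  simp [h]

lemma colLen_pathDiagram (m : ℕ) (w : List Step) (c : ℕ) :
    (pathDiagram m w).colLen c = ((pathRowLens w).filter (c < · + m)).length := by
  refine eq_of_forall_lt_iff fun r => ?_
  rw [← YoungDiagram.mem_iff_lt_colLen, mem_pathDiagram]
  have h := pathRowLens_sorted m w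
  rw [List.sortedGE_iff_pairwise] at h
  have h1 := lt_length_filter_iff h c r
  rw [List.filter_map, List.length_map] at h1
  simp only [Function.comp_def] at h1
  rw [h1]
  simp

lemma getElem?_pathRowLens (A L : List Step) :
    (pathRowLens (A ++ .V :: L))[A.count .V]? = some (L.count .H) := by
  induction A with
  | nil => simp [pathRowLens]
  | cons a A ih => cases a <;> simpa [pathRowLens] using ih

/-- The rows that reach the column of a given horizontal step are those whose vertical step precedes
it. -/
lemma length_filter_pathRowLens (A B : List Step) :
    ((pathRowLens (A ++ .H :: B)).filter (B.count .H < ·)).length = A.count .V := by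
  induction A with
  | nil =>
    rw [List.filter_eq_nil_iff.2]
    · simp
    · intro b hb
      simpa using pathRowLens_le B b (by simpa [pathRowLens] using hb)
  | cons a A ih =>
    cases a with
    | H => simpa [pathRowLens] using ih
    | V =>
      rw [List.cons_append, pathRowLens, List.filter_cons_of_pos (by simp; omega)]
      simpa using ih

lemma mem_placeColumn_of_le {n i r c : ℕ} {E : Finset (ℕ × ℕ)} (h : i ≤ r) :
    (r, c) ∈ placeColumn n E i ↔ (r, c) ∈ E := by
  unfold placeColumn
  split
  · rfl
  · simp
    omega

lemma placeColumn_eq {n i c : ℕ} {E : Finset (ℕ × ℕ)} (hc : c < n)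
    (h : ∀ r < i, (r, c) ∈ E) (h' : ∀ c', (∀ r < i, (r, c') ∈ E) → c' ≤ c) :
    placeColumn n E i = E.filter fun x => ¬ (x.2 = c ∧ x.1 < i) := by
  have : ((Finset.range n).filter fun c => ∀ r < i, (r, c) ∈ E).max = c := by
    refine le_antisymm ?_ ?_
    · rw [Finset.max_le_iff]
      intro a ha
      exact WithBot.coe_le_coe.2 (h' a (Finset.mem_filter.1 ha).2)
    · exact Finset.le_max (Finset.mem_filter.2 ⟨Finset.mem_range.2 hc, h⟩)
  unfold placeColumn
  rw [this]
  rfl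

/-! ### Invariants of the stack during Step 2 -/

namespace PathPair

variable {n k : ℕ} (W : PathPair n k)

lemma rowLen_shape {A L : List Step} (h : W.lower = A ++ .V :: L) :
    W.shape.rowLen (A.count .V) = L.count .H + 4 := by
  refine rowLen_pathDiagram ?_
  rw [h]
  exact getElem?_pathRowLens A L

lemma rowLen_shape_le (r : ℕ) : W.shape.rowLen r ≤ n - k := (omegaLD W).rowLen_le r

lemma mem_shape_sdiff_endBoxes {r c : ℕ} :
    (r, c) ∈ W.shape.cells \ W.endBoxes ↔ 1 ≤ c ∧ c + 1 < W.shape.rowLen r := by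
  simp only [endBoxes, Finset.mem_sdiff, Finset.mem_filter, YoungDiagram.mem_cells,
    YoungDiagram.mem_iff_lt_rowLen]
  omega

/-- The quadruple `(a, z, x, y)` describes row `r`: `a` is the label of the row, `z` its last
column, and `x` and `y` are the rightmost columns in which row `r` of `E` has a box. -/
structure RowSpec (E : Finset (ℕ × ℕ)) (r : ℕ) (q : ℕ × ℕ × ℕ × ℕ) : Prop where
  label : q.1 = r + (n - k - W.shape.rowLen r)
  last : q.2.1 + 1 = W.shape.rowLen r
  x_lt : q.2.2.1 < q.2.1
  y_lt : q.2.2.2 < q.2.2.1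
  y_pos : 1 ≤ q.2.2.2
  mem : ∃ S : List ℕ, (q.2.2.1 :: q.2.2.2 :: S).Pairwise (· > ·) ∧
    ∀ c, (r, c) ∈ E ↔ c ∈ q.2.2.1 :: q.2.2.2 :: S

variable {W} in
-- A column of height at most `r` does not reach row `r`. As the heights decrease weakly during Step
-- 2, a recorded row stays as it is.
lemma RowSpec.placeColumn {E : Finset (ℕ × ℕ)} {r i : ℕ} {q : ℕ × ℕ × ℕ × ℕ}
    (h : W.RowSpec E r q) (hi : i ≤ r) : W.RowSpec (placeColumn n E i) r q := by
  refine ⟨h.1, h.2, h.3, h.4, h.5, ?_⟩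
  obtain ⟨S, h1, h2⟩ := h.mem
  exact ⟨S, h1, fun c => by rw [mem_placeColumn_of_le hi, h2]⟩

/-- The set `E` of empty boxes is described above row `i` by the stack `S`, when the columns up to
number `f` have been made available. -/
structure StackSpec (E : Finset (ℕ × ℕ)) (i f : ℕ) (S : List ℕ) : Prop where
  sorted : S.Pairwise (· > ·)
  bound : ∀ c ∈ S, 1 ≤ c ∧ c < f
  mem : ∀ r < i, ∀ c, (r, c) ∈ E ↔ 1 ≤ c ∧ c + 1 < W.shape.rowLen r ∧ (c ∈ S ∨ f ≤ c)

variable {W} in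
-- Row `i - 1` is the shortest of the rows that the new column meets, and its last column is `f`.
-- Its empty boxes are therefore the stack, and the top `c` is the rightmost place where the column
-- fits. For `i = 0` nothing is placed.
lemma StackSpec.placeColumn {E : Finset (ℕ × ℕ)} {i f c : ℕ} {S : List ℕ}
    (h : W.StackSpec E i f (c :: S)) (hf : 0 < i → W.shape.rowLen (i - 1) = f + 1) :
    W.StackSpec (placeColumn n E i) i f S := by
  obtain ⟨h1, h2⟩ := List.pairwise_cons.1 h.sorted
  refine ⟨h2, fun c hc => h.bound c (List.mem_cons_of_mem _ hc), fun r hr c' => ?_⟩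
  have hi : 0 < i := by omega
  have hle : ∀ r < i, f + 1 ≤ W.shape.rowLen r := fun r hr => by
    rw [← hf hi]
    exact W.shape.rowLen_anti _ _ (by omega)
  have hb := h.bound c List.mem_cons_self
  have hn := W.rowLen_shape_le (i - 1)
  have hmem : ∀ r < i, (r, c) ∈ E := fun r hr => by
    rw [h.mem r hr]
    have := hle r hr
    exact ⟨hb.1, by omega, .inl List.mem_cons_self⟩
  -- Row `i - 1` alone bounds the position: columns from `f` on are not interior to it.
  have hmax : ∀ c', (∀ r < i, (r, c') ∈ E) → c' ≤ c := fun c' hc' => by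
    obtain ⟨-, h4, h5⟩ := (h.mem _ (by omega) c').1 (hc' (i - 1) (by omega))
    rw [hf hi] at h4
    rcases h5 with h5 | h5
    · rcases List.mem_cons.1 h5 with h5 | h5
      · exact h5.le
      · exact (h1 _ h5).le
    · omega
  have := hf hi
  rw [placeColumn_eq (by omega) hmem hmax, Finset.mem_filter, h.mem r hr, List.mem_cons]
  have hc : c ∉ S := fun h' => lt_irrefl _ (h1 _ h')
  simp only [hr, and_true]
  constructor
  · rintro ⟨⟨h3, h4, h5⟩, h6⟩
    exact ⟨h3, h4, by tauto⟩
  · rintro ⟨h3, h4, h5⟩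
    refine ⟨⟨h3, h4, by tauto⟩, ?_⟩
    rintro rfl
    rcases h5 with h5 | h5
    · exact hc h5
    · omega

end PathPair

/-- Induction along the reading: the columns placed so far are those of the `H` in the suffix `U`,
the rows above `A.count .V` are still open and governed by the stack, and the others are final. `hU`
says that pops begin only when the current block of `L` has been read completely. -/
theorem PathRun.spec {n k : ℕ} (W : PathPair n k) {s : ℕ} {L U : List Step} {S : List ℕ}
    {R : List (ℕ × ℕ × ℕ × ℕ)} (h : PathRun 3 s L U [2, 1] R S) {A B : List Step}
    (hA : W.lower = A ++ L) (hB : W.upper = B ++ U) (hs : s = A.length)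
    (hAB : A.count .V = B.count .V)
    (hU : U.head? = some .H → A = [] ∨ ∃ A', A = A' ++ [.V]) :
    W.StackSpec ((heights (A.count .V) U).foldl (placeColumn n) (W.shape.cells \ W.endBoxes))
        (A.count .V) (3 + L.count .H) S ∧
      ∀ i q, R[i]? = some q →
        W.RowSpec ((heights (A.count .V) U).foldl (placeColumn n) (W.shape.cells \ W.endBoxes))
          (A.count .V + i) q := by
  generalize hS : [2, 1] = S₀ at h
  induction h generalizing A B with
  | nil s S =>
    subst hS
    refine ⟨⟨by simp, by simp, fun r hr c => ?_⟩, by simp⟩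
    rw [heights, List.foldl_nil, W.mem_shape_sdiff_endBoxes]
    simp
    omega
  | @push s L U S R S' h hh ih =>
    have h1 := ih (A := A ++ [.H]) (by simpa using hA) hB (by simp [hs]) (by simpa using hAB)
      (fun h => absurd h hh) hS
    rw [List.count_append, List.count_singleton, if_neg (by decide), add_zero] at h1
    obtain ⟨⟨h2, h3, h4⟩, h5⟩ := h1
    refine ⟨⟨?_, ?_, fun r hr c => ?_⟩, h5⟩
    · exact List.pairwise_cons.2 ⟨fun c hc => (h3 c hc).2, h2⟩
    · rw [List.count_cons_self]
      intro c hc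
      rcases List.mem_cons.1 hc with rfl | hc
      · omega
      · have := h3 c hc
        omega
    · rw [h4 r hr, List.count_cons_self, List.mem_cons]
      have : 3 + L.count .H ≤ c ↔ c = 3 + L.count .H ∨ 3 + (L.count .H + 1) ≤ c := by omega
      rw [this]
      tauto
  | @pop s L U S R c S' h ih =>
    have hU' := hU rfl
    have h1 := ih (B := B ++ [.H]) hA (by simpa using hB) hs (by simpa using hAB) (fun _ => hU') hS
    rw [heights, List.foldl_append, List.foldl_cons, List.foldl_nil]
    refine ⟨h1.1.placeColumn fun hi => ?_, fun i q hq => (h1.2 i q hq).placeColumn (by omega)⟩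
    -- Either no row lies above, or the next letter of the lower word is the vertical step of the
    -- lowest row above, whose last column is then the next column `3 + L.count .H`.
    rcases hU' with rfl | ⟨A', rfl⟩
    · simp at hi
    · have := W.rowLen_shape (A := A') (L := L) (by simpa using hA)
      simp only [List.count_append, List.count_singleton_self, Nat.add_sub_cancel, this]
      omega
  | @sync s L U S R x y S' h ih =>
    have h1 := ih (A := A ++ [.V]) (B := B ++ [.V]) (by simpa using hA) (by simpa using hB)
      (by simp [hs]) (by simpa using hAB) (fun _ => .inr ⟨A, rfl⟩) hS
    rw [List.count_append, List.count_singleton_self] at h1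
    obtain ⟨⟨h2, h3, h4⟩, h5⟩ := h1
    have h6 := W.rowLen_shape hA
    rw [heights, List.count_cons_of_ne (by decide)]
    refine ⟨⟨h2, h3, fun r hr => h4 r (by omega)⟩, fun i q hq => ?_⟩
    cases i with
    | succ i =>
      have := h5 i q hq
      rwa [add_assoc, add_comm 1] at this
    | zero =>
      obtain rfl : _ = q := by simpa using hq
      have hx := h3 x (by simp)
      have hy := h3 y (by simp)
      refine ⟨?_, ?_, hx.2, ?_, hy.1, S', h2, fun c => ?_⟩
      · have := W.count_H_lower
        have h7 := congrArg (List.count Step.H) hA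
        have h8 := count_H_add_count_V A
        simp only [List.count_append, List.count_cons_of_ne (show Step.V ≠ .H by decide)] at h7
        simp only [add_zero, h6, hs]
        omega
      · simp only [add_zero, h6]
        omega
      · exact (List.pairwise_cons.1 h2).1 y (by simp)
      -- The last column of this row is `3 + L.count .H`, so its interior contains no column beyond
      -- the stack.
      · rw [add_zero, h4 _ (by omega)]
        simp only [h6]
        constructor
        · rintro ⟨h7, h8, h9 | h9⟩
          · exact h9
          · omega
        · intro h7
          have := h3 c h7
          exact ⟨this.1, by omega, .inl h7⟩

lemma PathRun.length_rows {f s : ℕ} {L U : List Step} {S S' : List ℕ} {R : List (ℕ × ℕ × ℕ × ℕ)}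
    (h : PathRun f s L U S R S') : R.length = L.count .V := by
  induction h with
  | nil => rfl
  | push _ _ ih => simpa using ih
  | pop _ ih => exact ih
  | sync _ ih => simpa using ih

/-! ### The boxes with `+` in each row -/

namespace PathPair

variable {n k : ℕ} (W : PathPair n k)

lemma count_H_upper : W.upper.count .H = n - k - 4 := by
  have h1 := W.length_upper
  have h2 := W.count_upper
  have := count_H_add_count_V W.upper
  omega

lemma emptyBoxes_eq : W.emptyBoxes =
    (heights 0 W.upper).foldl (placeColumn n) (W.shape.cells \ W.endBoxes) := by
  rw [emptyBoxes, heights_eq, count_H_upper]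
  congr 1
  refine List.map_congr_left fun c _ => ?_
  rw [colLen_pathDiagram]
  simp

/-- Step 3 chooses an empty box if and only if fewer than two empty boxes lie to its right; in a
decreasing list of columns these are the first two entries. -/
lemma mem_plusBoxes_of_rowSpec {r : ℕ} {q : ℕ × ℕ × ℕ × ℕ} (h : W.RowSpec W.emptyBoxes r q)
    (c : ℕ) : (r, c) ∈ W.plusBoxes ↔ c = 0 ∨ c = q.2.2.2 ∨ c = q.2.2.1 ∨ c = q.2.1 := by
  obtain ⟨S, h1, h2⟩ := h.mem
  have h3 := h.last
  have h4 := h.x_lt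
  have h5 := h.y_lt
  obtain ⟨h6, h7⟩ := List.pairwise_cons.1 h1
  obtain ⟨h8, h9⟩ := List.pairwise_cons.1 h7
  have hin : (r, c) ∈ W.innerBoxes ↔ c = q.2.2.1 ∨ c = q.2.2.2 := by
    rw [innerBoxes, Finset.mem_filter, h2]
    have hE : ∀ c, (W.emptyBoxes.filter fun y => y.1 = r ∧ c < y.2).card =
        ((q.2.2.1 :: q.2.2.2 :: S).toFinset.filter (c < ·)).card := by
      intro c
      rw [← Finset.card_map (⟨fun c => (r, c), fun a b h => (Prod.ext_iff.1 h).2⟩ : ℕ ↪ ℕ × ℕ)]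
      congr 1
      ext ⟨r', c'⟩
      simp only [Finset.mem_filter, Finset.mem_map, List.mem_toFinset]
      constructor
      · rintro ⟨h10, rfl, h12⟩
        exact ⟨c', ⟨(h2 c').1 h10, h12⟩, rfl⟩
      · rintro ⟨c'', ⟨h10, h11⟩, h12⟩
        obtain ⟨rfl, rfl⟩ := Prod.mk.inj h12
        exact ⟨(h2 _).2 h10, rfl, h11⟩
    simp only [hE]
    constructor
    · rintro ⟨h10, h11⟩
      rcases List.mem_cons.1 h10 with h10 | h10
      · exact .inl h10
      rcases List.mem_cons.1 h10 with h10 | h10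
      · exact .inr h10
      have h12 := h8 _ h10
      have h13 : ({q.2.2.1, q.2.2.2} : Finset ℕ) ⊆
          (q.2.2.1 :: q.2.2.2 :: S).toFinset.filter (c < ·) := by
        intro a ha
        rcases Finset.mem_insert.1 ha with rfl | ha
        · simp
          omega
        · rw [Finset.mem_singleton.1 ha]
          simp
          omega
      have h14 := Finset.card_le_card h13
      rw [Finset.card_pair (by omega)] at h14
      omega
    · intro h10
      refine ⟨by rcases h10 with h10 | h10 <;> simp [h10], ?_⟩
      have h13 : (q.2.2.1 :: q.2.2.2 :: S).toFinset.filter (c < ·) ⊆ {q.2.2.1} := by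
        intro a ha
        obtain ⟨h11, h12⟩ := Finset.mem_filter.1 ha
        rw [List.mem_toFinset, List.mem_cons, List.mem_cons] at h11
        rcases h11 with rfl | rfl | h11
        · simp
        · omega
        · have := h8 _ h11
          omega
      have := Finset.card_le_card h13
      rw [Finset.card_singleton] at this
      omega
  rw [plusBoxes, Finset.mem_union, hin, endBoxes, Finset.mem_filter, YoungDiagram.mem_cells,
    YoungDiagram.mem_iff_lt_rowLen]
  simp only
  omega

end PathPair

/-! ## The permutation of a diagram as a product of cycles of length five -/

/-- The cycle `a ↦ z ↦ x ↦ y ↦ N ↦ a`. -/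
def fiveCycle (a z x y N i : ℕ) : ℕ :=
  if i = a then z else if i = z then x else if i = x then y else if i = y then N
  else if i = N then a else i

/-- The product of the cycles that correspond to the rows in `R`, where columns are labelled by
`lab`. -/
def rowsMap (lab : ℕ → ℕ) (N : ℕ) (R : List (ℕ × ℕ × ℕ × ℕ)) (i : ℕ) : ℕ :=
  R.foldr (fun q v => fiveCycle q.1 (lab q.2.1) (lab q.2.2.1) (lab q.2.2.2) N v) i

@[simp] lemma rowsMap_nil (lab : ℕ → ℕ) (N i : ℕ) : rowsMap lab N [] i = i := rfl

@[simp] lemma rowsMap_cons (lab : ℕ → ℕ) (N i : ℕ) (q : ℕ × ℕ × ℕ × ℕ)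
    (R : List (ℕ × ℕ × ℕ × ℕ)) : rowsMap lab N (q :: R) i =
      fiveCycle q.1 (lab q.2.1) (lab q.2.2.1) (lab q.2.2.2) N (rowsMap lab N R i) := rfl

@[simp] lemma rowsMap_append (lab : ℕ → ℕ) (N i : ℕ) (R R' : List (ℕ × ℕ × ℕ × ℕ)) :
    rowsMap lab N (R ++ R') i = rowsMap lab N R (rowsMap lab N R' i) := by
  simp [rowsMap, List.foldr_append]

lemma rowsMap_eq_self {lab : ℕ → ℕ} {N i : ℕ} {R : List (ℕ × ℕ × ℕ × ℕ)}
    (h : ∀ q ∈ R, i ≠ q.1 ∧ i ≠ lab q.2.1 ∧ i ≠ lab q.2.2.1 ∧ i ≠ lab q.2.2.2 ∧ i ≠ N) :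
    rowsMap lab N R i = i := by
  induction R with
  | nil => rfl
  | cons q R ih =>
    obtain ⟨h1, h2, h3, h4, h5⟩ := h q List.mem_cons_self
    rw [rowsMap_cons, ih fun q hq => h q (List.mem_cons_of_mem _ hq)]
    simp [fiveCycle, *]

namespace OplusDiagram

variable {k n : ℕ} (D : OplusDiagram k n)

lemma rowLabel_inj {r r' : ℕ} (hr : r < k) (hr' : r' < k) (h : D.rowLabel r = D.rowLabel r') :
    r = r' := by
  have := D.borderLabel_injective (a₁ := .inl ⟨r, hr⟩) (a₂ := .inl ⟨r', hr'⟩) (Fin.ext h)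
  simpa using this

lemma colLabel_inj {c c' : ℕ} (hc : c < n - k) (hc' : c' < n - k)
    (h : D.colLabel c = D.colLabel c') : c = c' := by
  have := D.borderLabel_injective (a₁ := .inr ⟨c, hc⟩) (a₂ := .inr ⟨c', hc'⟩) (Fin.ext h)
  simpa using this

lemma pipe_border (s : Fin k ⊕ Fin (n - k)) :
    (D.pipe (D.border s) : ℕ) = D.pipeEnd (D.borderEdge s) := by
  simp [pipe]

lemma pipeEnd_vert_eq {r c c' : ℕ} (hc : c' < c) (h : (r, c') ∈ D.plus)
    (h' : ∀ b, c' < b → b < c → (r, b) ∉ D.plus) :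
    D.pipeEnd (.vert r c) = D.pipeEnd (.horiz r c') := by
  induction c with
  | zero => omega
  | succ c ih =>
    rw [pipeEnd]
    rcases eq_or_ne c' c with rfl | hne
    · rw [if_pos h]
    · rw [if_neg (h' c (by omega) (by omega)),
        ih (by omega) fun b hb hb' => h' b hb (by omega)]

/-- The quadruple `(a, z, x, y)` describes row `r` of the diagram: `a` is its label and the boxes
filled with `+` are those in the last column `z` and in the columns `x`, `y`, and `0`. -/
structure RowPlus (r : ℕ) (q : ℕ × ℕ × ℕ × ℕ) : Prop where
  label : q.1 = D.rowLabel r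
  last : q.2.1 + 1 = D.shape.rowLen r
  x_lt : q.2.2.1 < q.2.1
  y_lt : q.2.2.2 < q.2.2.1
  y_pos : 1 ≤ q.2.2.2
  mem : ∀ c, (r, c) ∈ D.plus ↔ c = 0 ∨ c = q.2.2.2 ∨ c = q.2.2.1 ∨ c = q.2.1

variable {D} in
-- Entering a `+` from below, the pipe turns west and then north at the next `+`; from column 0 it
-- leaves through the left border.
lemma RowPlus.pipeEnd_horiz {r : ℕ} {q : ℕ × ℕ × ℕ × ℕ} (h : D.RowPlus r q) (c : ℕ) :
    D.pipeEnd (.horiz (r + 1) c) =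
      if c = q.2.1 then D.pipeEnd (.horiz r q.2.2.1)
      else if c = q.2.2.1 then D.pipeEnd (.horiz r q.2.2.2)
      else if c = q.2.2.2 then D.pipeEnd (.horiz r 0)
      else if c = 0 then D.rowLabel r else D.pipeEnd (.horiz r c) := by
  have h1 := h.mem
  have h2 := h.x_lt
  have h3 := h.y_lt
  have h4 := h.y_pos
  rw [pipeEnd]
  split_ifs with h5 h6 h7 h8 h9 h6 h7 h8 h9
  · subst h6
    exact D.pipeEnd_vert_eq h2 ((h1 _).2 (by simp)) fun b hb hb' => by rw [h1]; omega
  · subst h7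
    exact D.pipeEnd_vert_eq h3 ((h1 _).2 (by simp)) fun b hb hb' => by rw [h1]; omega
  · subst h8
    exact D.pipeEnd_vert_eq h4 ((h1 _).2 (by simp)) fun b hb hb' => by rw [h1]; omega
  · subst h9
    rw [pipeEnd]
  · rw [h1] at h5
    omega
  all_goals first | rfl | (rw [h1] at h5; omega)

variable {D} {R : List (ℕ × ℕ × ℕ × ℕ)}

section

variable (hk : R.length = k) (hR : ∀ r q, R[r]? = some q → D.RowPlus r q)

include hk hR

/-- A pipe going north from height `r` only meets the rows above, the lowest one first. -/
lemma pipeEnd_horiz_eq_rowsMap {r : ℕ} (hr : r ≤ k) {c : ℕ} (hc : c < n - k) :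
    D.pipeEnd (.horiz r c) = rowsMap D.colLabel (D.colLabel 0) (R.take r) (D.colLabel c) := by
  induction r generalizing c with
  | zero => rw [pipeEnd]; simp
  | succ r ih =>
    have hr' : r < R.length := by omega
    have h := hR r R[r] (List.getElem?_eq_getElem hr')
    have hlen := D.rowLen_le r
    obtain ⟨h1, h2, h3, h4, h5, -⟩ := id h
    have hrow : ∀ {c}, c < n - k → D.colLabel c ≠ D.rowLabel r := fun {c} hc =>
      (D.rowLabel_ne_colLabel ⟨r, by omega⟩ ⟨c, hc⟩).symm
    have hcol : ∀ {c c'}, c < n - k → c' < n - k →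
        (D.colLabel c = D.colLabel c' ↔ c = c') := fun {c c'} hc hc' =>
      ⟨D.colLabel_inj hc hc', fun h => h ▸ rfl⟩
    -- A pipe that leaves through the left border of row `r` has ended; the remaining factors must
    -- not move its label.
    have hfix : rowsMap D.colLabel (D.colLabel 0) (R.take r) (D.rowLabel r) = D.rowLabel r := by
      refine rowsMap_eq_self fun q hq => ?_
      obtain ⟨r', hr1, rfl⟩ := List.mem_take_iff_getElem.1 hq
      have g := hR r' _ (List.getElem?_eq_getElem (by omega))
      have glen := D.rowLen_le r'
      obtain ⟨g1, g2, g3, g4, g5, -⟩ := g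
      rw [g1]
      refine ⟨fun h => ?_, ?_, ?_, ?_, ?_⟩
      · have := D.rowLabel_inj (by omega) (by omega) h
        omega
      all_goals exact (hrow (by omega)).symm
    rw [h.pipeEnd_horiz, List.take_succ_eq_append_getElem hr', rowsMap_append, rowsMap_cons,
      rowsMap_nil, h1, fiveCycle, if_neg (hrow hc)]
    simp only [hcol hc (show R[r].2.1 < n - k by omega),
      hcol hc (show R[r].2.2.1 < n - k by omega), hcol hc (show R[r].2.2.2 < n - k by omega),
      hcol hc (show 0 < n - k by omega)]
    split_ifs
    · exact ih (by omega) (by omega)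
    · exact ih (by omega) (by omega)
    · exact ih (by omega) (by omega)
    · exact hfix.symm
    · exact ih (by omega) (by omega)

/-- The rows below the start of a pipe do not involve its label. If it starts at a row, that row
contributes a ↦ z: the `+` in the last column turns it north at once. -/
lemma pipe_eq_rowsMap (i : Fin n) :
    (D.pipe i : ℕ) = rowsMap D.colLabel (D.colLabel 0) R i := by
  obtain ⟨s, rfl⟩ := D.border.surjective i
  rw [pipe_border]
  rcases s with ⟨r, hr₀⟩ | c
  · have hr : r < R.length := by omega
    have hrow : ∀ {c}, c < n - k → D.rowLabel r ≠ D.colLabel c := fun {c} hc =>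
      D.rowLabel_ne_colLabel ⟨r, hr₀⟩ ⟨c, hc⟩
    have h := hR r R[r] (List.getElem?_eq_getElem hr)
    have hlen := D.rowLen_le r
    obtain ⟨h1, h2, h3, h4, h5, h6⟩ := id h
    have hfix : rowsMap D.colLabel (D.colLabel 0) (R.drop (r + 1)) (D.rowLabel r) =
        D.rowLabel r := by
      refine rowsMap_eq_self fun q hq => ?_
      obtain ⟨r', hr1, rfl⟩ := List.mem_drop_iff_getElem.1 hq
      have g := hR _ _ (List.getElem?_eq_getElem (l := R) (i := r + 1 + r') (by omega))
      have glen := D.rowLen_le (r + 1 + r')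
      obtain ⟨g1, g2, g3, g4, g5, -⟩ := g
      rw [g1]
      refine ⟨fun h => ?_, ?_, ?_, ?_, ?_⟩
      · have := D.rowLabel_inj hr₀ (by omega) h
        omega
      all_goals exact hrow (by omega)
    have hb : ((D.border (.inl ⟨r, hr₀⟩) : Fin n) : ℕ) = D.rowLabel r := rfl
    have he : D.borderEdge (.inl ⟨r, hr₀⟩) = .vert r (D.shape.rowLen r) := rfl
    simp only [hb, he]
    conv_rhs => rw [← List.take_append_drop (r + 1) R, rowsMap_append, hfix,
      List.take_succ_eq_append_getElem hr, rowsMap_append, rowsMap_cons, rowsMap_nil, h1,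
      fiveCycle, if_pos rfl]
    rw [← pipeEnd_horiz_eq_rowsMap hk hR hr₀.le (by omega)]
    exact D.pipeEnd_vert_eq (by omega) ((h6 _).2 (by simp)) fun b hb hb' => by omega
  · have hc := c.2
    have hlen := D.colLen_le c
    have hfix : rowsMap D.colLabel (D.colLabel 0) (R.drop (D.shape.colLen c)) (D.colLabel c) =
        D.colLabel c := by
      refine rowsMap_eq_self fun q hq => ?_
      obtain ⟨r', hr1, rfl⟩ := List.mem_drop_iff_getElem.1 hq
      have g := hR _ _ (List.getElem?_eq_getElem (l := R) (i := D.shape.colLen c + r') (by omega))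
      obtain ⟨g1, g2, g3, g4, g5, -⟩ := g
      have glen := D.rowLen_le (D.shape.colLen c + r')
      -- Rows below the foot of column `c` end to the left of it, so none of their `+` lies in
      -- column `c`.
      have : D.shape.rowLen (D.shape.colLen c + r') ≤ c := by
        by_contra! hlt
        have := YoungDiagram.mem_iff_lt_colLen.1 (YoungDiagram.mem_iff_lt_rowLen.2 hlt)
        omega
      rw [g1]
      refine ⟨(D.rowLabel_ne_colLabel ⟨_, by omega⟩ c).symm, ?_, ?_, ?_, ?_⟩
      all_goals
        intro h
        have := D.colLabel_inj c.2 (by omega) h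
        omega
    have hb : ((D.border (.inr c) : Fin n) : ℕ) = D.colLabel c := rfl
    have he : D.borderEdge (.inr c) = .horiz (D.shape.colLen c) c := rfl
    simp only [hb, he]
    conv_rhs => rw [← List.take_append_drop (D.shape.colLen c) R, rowsMap_append, hfix]
    exact pipeEnd_horiz_eq_rowsMap hk hR hlen hc

end

/-- A pipe that is above row `r₀` cannot end in row `r₀`. -/
lemma pipeEnd_ne_rowLabel (D : OplusDiagram k n) {r₀ : ℕ} (hr₀ : r₀ < k) (e : GridEdge)
    (he : D.Inside e) (h : match e with | .vert r _ => r < r₀ | .horiz r _ => r ≤ r₀) :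
    D.pipeEnd e ≠ D.rowLabel r₀ := by
  fun_induction pipeEnd D e with
  | case1 r =>
    intro h'
    have := D.rowLabel_inj he.1 hr₀ h'
    simp only at h
    omega
  | case2 r c hp ih =>
    have h2 := D.plus_subset _ hp
    exact ih ⟨(D.fits _ h2).2, (YoungDiagram.mem_iff_lt_colLen.1 h2).le⟩ (le_of_lt h)
  | case3 r c hp ih => exact ih ⟨he.1, (Nat.le_succ c).trans he.2⟩ h
  | case4 c => exact (D.rowLabel_ne_colLabel ⟨r₀, hr₀⟩ ⟨c, he.1⟩).symm
  | case5 r c hp ih =>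
    have h2 := D.plus_subset _ hp
    exact ih ⟨(D.fits _ h2).1, (YoungDiagram.mem_iff_lt_rowLen.1 h2).le⟩ (Nat.lt_of_succ_le h)
  | case6 r c hp ih => exact ih ⟨he.1, (Nat.le_succ r).trans he.2⟩ ((Nat.le_succ r).trans h)

/-- The `+` at the right end turns the pipe of a row north, and pipes never move south again. -/
lemma decPerm_white_eq_empty (D : OplusDiagram k n)
    (h : ∀ r < k, ∃ c, D.shape.rowLen r = c + 1 ∧ (r, c) ∈ D.plus) : D.decPerm.white = ∅ := by
  rw [Set.eq_empty_iff_forall_notMem]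
  rintro i ⟨h1, r, rfl⟩
  have h2 := congrArg Fin.val h1
  obtain ⟨c, hc, hp⟩ := h r r.2
  have hs := D.plus_subset _ hp
  have he : D.borderEdge (.inl r) = .vert r (D.shape.rowLen r) := rfl
  rw [pipe_border, he, hc, pipeEnd, if_pos hp] at h2
  exact D.pipeEnd_ne_rowLabel r.2 (.horiz r c)
    ⟨(D.fits _ hs).2, (YoungDiagram.mem_iff_lt_colLen.1 hs).le⟩ le_rfl h2

end OplusDiagram

/-! ## Five-cycles with increasing labels -/

section FiveCycle

variable {a z x y N : ℕ}

lemma fiveCycle_a : fiveCycle a z x y N a = z := by simp [fiveCycle]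

/-- The cases of `fiveCycle` are tested in turn, so later entries must differ from earlier ones.
This holds for rows since labels grow towards the left: a < z < x < y < N. -/
lemma fiveCycle_z (h1 : a < z) : fiveCycle a z x y N z = x := by
  simp [fiveCycle, h1.ne']

lemma fiveCycle_x (h1 : a < z) (h2 : z < x) : fiveCycle a z x y N x = y := by
  simp [fiveCycle, h2.ne', (h1.trans h2).ne']

lemma fiveCycle_y (h1 : a < z) (h2 : z < x) (h3 : x < y) : fiveCycle a z x y N y = N := by
  simp [fiveCycle, h3.ne', (h2.trans h3).ne', (h1.trans (h2.trans h3)).ne']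

lemma fiveCycle_N (h1 : a < z) (h2 : z < x) (h3 : x < y) (h4 : y < N) :
    fiveCycle a z x y N N = a := by
  simp [fiveCycle, h4.ne', (h3.trans h4).ne', (h2.trans (h3.trans h4)).ne',
    (h1.trans (h2.trans (h3.trans h4))).ne']

lemma fiveCycle_of_ne {i : ℕ} (h1 : i ≠ a) (h2 : i ≠ z) (h3 : i ≠ x) (h4 : i ≠ y) (h5 : i ≠ N) :
    fiveCycle a z x y N i = i := by
  simp [fiveCycle, *]

lemma fiveCycle_injective (h1 : a < z) (h2 : z < x) (h3 : x < y) (h4 : y < N) :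
    Function.Injective (fiveCycle a z x y N) := by
  intro i j h
  unfold fiveCycle at h
  split_ifs at h <;> omega

end FiveCycle

/-! ## The ends of the trips through a subtree -/

/-- The places where a trip can enter or leave the part of the plabic graph that comes from a
vertex of the tree and its descendants: its white end, its black end, and its leaves, which are
numbered from `0` in the whole tree. -/
inductive Gate where
  | w
  | b
  | leaf (g : ℕ)

namespace Gate

/-- The dart at a gate that leads to the outside. -/
def dart {n : ℕ} (T : BinaryTree Unit) (p : List Step) : Gate → RawDart n
  | w => .at p .wOut
  | b => .at p .bOut
  | leaf g => .at ((leafList T).getD g []) .leaf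

/-- The gates of a subtree whose leaves are those with the numbers `s, …, s + l + 1`. -/
def Valid (s l : ℕ) : Gate → Prop
  | leaf g => s ≤ g ∧ g ≤ s + l + 1
  | _ => True

/-- The label of the pipe that corresponds to the trip that enters at a gate. -/
def source (s l X Y N : ℕ) : Gate → ℕ
  | w => s
  | b => N
  | leaf g => if g < s + l then g + 1 else if g = s + l then X else Y

/-- The label at which the pipe ends that corresponds to a trip that leaves at a gate. -/
def target (s X Y N : ℕ) : Gate → ℕ
  | w => Y
  | b => X
  | leaf g => if g = s then N else g - 1

lemma valid_mono {s l s' l' : ℕ} {e : Gate} (h : e.Valid s l) (h1 : s' ≤ s)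
    (h2 : s + l ≤ s' + l') : e.Valid s' l' := by
  cases e with
  | leaf g =>
    obtain ⟨h3, h4⟩ := h
    exact ⟨by omega, by omega⟩
  | _ => trivial

end Gate

section

variable {n : ℕ} {T : BinaryTree Unit} (hn : T.numLeaves + 2 = n)

/-- The trip that arrives through the dart `d` leaves the part of the graph that belongs to the
vertex `p` at the gate `e`, and `i` is the label with this target. -/
def Exits (p : List Step) (s l X Y N : ℕ) (d : RawDart n) (i : ℕ) (e : Gate) : Prop :=
  e.Valid s l ∧ Go T hn d (e.dart T p) ∧ i = e.target s X Y N

/-- The trips through the part of the graph that belongs to the vertex `p` are described by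
the permutation `D` of the labels. -/
structure TripSpec (p : List Step) (s l X Y N : ℕ) (D : ℕ → ℕ) : Prop where
  exits : ∀ e : Gate, e.Valid s l →
    ∃ e', Exits hn p s l X Y N (e.dart T p) (D (e.source s l X Y N)) e'
  exits_w : ∃ g, Exits hn p s l X Y N (.at p .wOut) (D s) (.leaf g)
  exits_b : ∃ g, Exits hn p s l X Y N (.at p .bOut) (D N) (.leaf g)
  fixed : ∀ i, i < s ∨ s + l < i → i ≠ X → i ≠ Y → i ≠ N → D i = i
  injective : Function.Injective D

variable {hn}

section Node

variable {p : List Step} {s l X Y N : ℕ}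

/-- With no rows the permutation is the identity; the four trips white end → leaf s + 1, black end →
leaf s, leaf s → black end, leaf s + 1 → white end carry the labels s, N, X, Y. -/
lemma tripSpec_leaf_leaf {u : Unit} (hp : subtreeAt T p = some (.node u .nil .nil))
    (h0 : (leafList T).getD s [] = .H :: p) (h1 : (leafList T).getD (s + 1) [] = .V :: p) :
    TripSpec hn p s 0 X Y N id := by
  have hH : subtreeAt T (.H :: p) = some .nil := by simp [subtreeAt, hp, child]
  have hV : subtreeAt T (.V :: p) = some .nil := by simp [subtreeAt, hp, child]
  have hw : Exits hn p s 0 X Y N (.at p .wOut) s (.leaf (s + 1)) := by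
    refine ⟨by simp [Gate.Valid], ?_, by simp [Gate.target]⟩
    rw [Gate.dart, h1]
    exact go_wOut_trans hn hp (go_H_bOut hn (go_leafH_wOut hn hH) (go_leafV_wOut hn hV))
  have hb : Exits hn p s 0 X Y N (.at p .bOut) N (.leaf s) := by
    refine ⟨by simp [Gate.Valid], ?_, by simp [Gate.target]⟩
    rw [Gate.dart, h0]
    exact go_bOut_trans hn hp (go_V_wOut hn (go_leafV_bOut hn hV) (go_leafH_bOut hn hH))
  refine ⟨?_, ⟨_, hw⟩, ⟨_, hb⟩, fun i _ _ _ _ => rfl, Function.injective_id⟩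
  rintro (_ | _ | g) hg
  · exact ⟨_, hw⟩
  · exact ⟨_, hb⟩
  · obtain rfl | rfl : g = s ∨ g = s + 1 := by
      simp only [Gate.Valid] at hg
      omega
    · refine ⟨.b, trivial, ?_, by simp [Gate.source, Gate.target]⟩
      rw [Gate.dart, Gate.dart, h0]
      exact go_H_wOut hn hp (go_leafH_leaf hn hH)
    · refine ⟨.w, trivial, ?_, by simp [Gate.source, Gate.target]⟩
      rw [Gate.dart, Gate.dart, h1]
      exact go_V_bOut hn hp (go_leafV_leaf hn hV)

/-- No row is added. A trip that leaves the horizontal child at its black end goes on to the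
vertical leaf s + l + 2, whose target s + l + 1 is the child's `X`; one that leaves at its white end
leaves at `b_p`, so the child's `Y` is the `X` of `p`. -/
lemma tripSpec_node_leaf {u : Unit} {tH : BinaryTree Unit} {D : ℕ → ℕ}
    (hp : subtreeAt T p = some (.node u tH .nil))
    (h1 : (leafList T).getD (s + l + 2) [] = .V :: p)
    (hH : TripSpec hn (.H :: p) s l (s + l + 1) X N D)
    (hX : s + l + 1 < X) (hXY : X < Y) (hY : Y < N) :
    TripSpec hn p s (l + 1) X Y N D := by
  have hV : subtreeAt T (.V :: p) = some .nil := by simp [subtreeAt, hp, child]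
  have hleaf : ∀ {d i g}, Exits hn (.H :: p) s l (s + l + 1) X N d i (.leaf g) →
      Exits hn p s (l + 1) X Y N d i (.leaf g) := fun ⟨h1, h2, h3⟩ =>
    ⟨Gate.valid_mono h1 le_rfl (by omega), h2, h3⟩
  have hexit : ∀ {d i e}, Exits hn (.H :: p) s l (s + l + 1) X N d i e →
      ∃ e', Exits hn p s (l + 1) X Y N d i e' := by
    rintro d i (_ | _ | g) he
    · exact ⟨.b, trivial, go_H_wOut hn hp he.2.1, he.2.2⟩
    · refine ⟨.leaf (s + l + 2), ⟨by omega, by omega⟩, ?_, ?_⟩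
      · rw [Gate.dart, h1]
        exact go_H_bOut hn he.2.1 (go_leafV_wOut hn hV)
      · have := he.2.2
        simp only [Gate.target] at this ⊢
        rw [if_neg (by omega)]
        omega
    · exact ⟨_, hleaf he⟩
  have hw : ∃ g, Exits hn p s (l + 1) X Y N (.at p .wOut) (D s) (.leaf g) := by
    obtain ⟨g, hg⟩ := hH.exits_w
    obtain ⟨g1, g2, g3⟩ := hleaf hg
    exact ⟨g, g1, go_wOut_trans hn hp g2, g3⟩
  have hb : ∃ g, Exits hn p s (l + 1) X Y N (.at p .bOut) (D N) (.leaf g) := by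
    obtain ⟨g, hg⟩ := hH.exits_b
    obtain ⟨g1, g2, g3⟩ := hleaf hg
    exact ⟨g, g1, go_bOut_trans hn hp (go_V_wOut hn (go_leafV_bOut hn hV) g2), g3⟩
  refine ⟨?_, hw, hb, fun i h1 h2 h3 h4 => hH.fixed i (by omega) (by omega) h2 h4, hH.injective⟩
  rintro (_ | _ | g) hg
  · obtain ⟨g, hg⟩ := hw
    exact ⟨_, hg⟩
  · obtain ⟨g, hg⟩ := hb
    exact ⟨_, hg⟩
  · obtain ⟨hg1, hg2⟩ := hg
    rcases eq_or_ne g (s + l + 2) with rfl | hne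
    · refine ⟨.w, trivial, ?_, ?_⟩
      · rw [Gate.dart, Gate.dart, h1]
        exact go_V_bOut hn hp (go_leafV_leaf hn hV)
      · rw [Gate.source, if_neg (by omega), if_neg (by omega), Gate.target,
          hH.fixed Y (by omega) (by omega) (by omega) (by omega)]
    · obtain ⟨e, he⟩ := hH.exits (.leaf g) ⟨hg1, by omega⟩
      -- The last two leaves of the child have the sources s + l + 1 and X in both labellings.
      have hsrc : (Gate.leaf g).source s (l + 1) X Y N =
          (Gate.leaf g).source s l (s + l + 1) X N := by
        simp only [Gate.source]
        split_ifs <;> omega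
      rw [hsrc]
      exact hexit he

/-- The horizontal leaf contributes no permutation. The cycle turns the exits of the vertical child
into exits of `p`: Y ↦ N is the passage to leaf s, X ↦ Y the exit at `w_p`, and N ↦ s the renaming
of the target of leaf s + 1. -/
lemma tripSpec_leaf_node {u : Unit} {tV : BinaryTree Unit} {z : ℕ} {D : ℕ → ℕ}
    (hp : subtreeAt T p = some (.node u .nil tV)) (h0 : (leafList T).getD s [] = .H :: p)
    (hV : TripSpec hn (.V :: p) (s + 1) l X Y N D) (hz : D (s + 1) = z) (hz1 : s + 1 ≤ z)
    (hz2 : z ≤ s + 1 + l) (hX : s + 1 + l < X) (hXY : X < Y) (hY : Y < N) :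
    TripSpec hn p s (l + 1) X Y N fun i => fiveCycle s z X Y N (D i) := by
  have hH : subtreeAt T (.H :: p) = some .nil := by simp [subtreeAt, hp, child]
  have c1 : s < z := by omega
  have c2 : z < X := by omega
  have hleaf : ∀ {d i g}, i ≠ s + 1 → Exits hn (.V :: p) (s + 1) l X Y N d (D i) (.leaf g) →
      Exits hn p s (l + 1) X Y N d (fiveCycle s z X Y N (D i)) (.leaf g) := by
    rintro d i g hi ⟨⟨h1, h1'⟩, h2, h3⟩
    refine ⟨⟨by omega, by omega⟩, h2, ?_⟩
    -- The cycle moves `z`, but by injectivity only the label s + 1 is sent there. For `p` it is the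
    -- source of the horizontal leaf and is treated separately.
    have hne : D i ≠ z := fun h => hi (hV.injective (h.trans hz.symm))
    simp only [Gate.target] at h3 ⊢
    rw [if_neg (by omega)]
    split_ifs at h3 with h4
    · rw [h3, fiveCycle_N c1 c2 hXY hY]
      omega
    · rw [fiveCycle_of_ne (by omega) hne (by omega) (by omega) (by omega), h3]
  have hexit : ∀ {d i e}, i ≠ s + 1 → Exits hn (.V :: p) (s + 1) l X Y N d (D i) e →
      ∃ e', Exits hn p s (l + 1) X Y N d (fiveCycle s z X Y N (D i)) e' := by
    rintro d i (_ | _ | g) hi he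
    · refine ⟨.leaf s, ⟨le_rfl, by omega⟩, ?_, ?_⟩
      · rw [Gate.dart, h0]
        exact go_V_wOut hn he.2.1 (go_leafH_bOut hn hH)
      · rw [he.2.2, Gate.target, Gate.target, if_pos rfl, fiveCycle_y c1 c2 hXY]
    · refine ⟨.w, trivial, go_V_bOut hn hp he.2.1, ?_⟩
      rw [he.2.2, Gate.target, Gate.target, fiveCycle_x c1 c2]
    · exact ⟨_, hleaf hi he⟩
  have hw : ∃ g, Exits hn p s (l + 1) X Y N (.at p .wOut) (fiveCycle s z X Y N (D s))
      (.leaf g) := by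
    obtain ⟨g, ⟨g1, g1'⟩, g2, g3⟩ := hV.exits_w
    refine ⟨g, ⟨by omega, by omega⟩,
      go_wOut_trans hn hp (go_H_bOut hn (go_leafH_wOut hn hH) g2), ?_⟩
    -- The arrow s ↦ z = D (s + 1) replaces the trip from `w_p` by the one entering the vertical
    -- child at its white end.
    rw [hV.fixed s (by omega) (by omega) (by omega) (by omega), fiveCycle_a, ← hz, g3]
    simp only [Gate.target] at g3 ⊢
    rw [if_neg (show g ≠ s by omega)]
    split_ifs at g3 ⊢ <;> omega
  have hb : ∃ g, Exits hn p s (l + 1) X Y N (.at p .bOut) (fiveCycle s z X Y N (D N))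
      (.leaf g) := by
    obtain ⟨g, hg⟩ := hV.exits_b
    obtain ⟨g1, g2, g3⟩ := hleaf (by omega) hg
    exact ⟨g, g1, go_bOut_trans hn hp g2, g3⟩
  refine ⟨?_, hw, hb, fun i h1 h2 h3 h4 => ?_,
    (fiveCycle_injective c1 c2 hXY hY).comp hV.injective⟩
  · rintro (_ | _ | g) hg
    · obtain ⟨g, hg⟩ := hw
      exact ⟨_, hg⟩
    · obtain ⟨g, hg⟩ := hb
      exact ⟨_, hg⟩
    · obtain ⟨hg1, hg2⟩ := hg
      rcases eq_or_ne g s with rfl | hne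
      · refine ⟨.b, trivial, ?_, ?_⟩
        · rw [Gate.dart, Gate.dart, h0]
          exact go_H_wOut hn hp (go_leafH_leaf hn hH)
        · rw [Gate.source, if_pos (by omega), Gate.target, hz, fiveCycle_z c1]
      · have hsrc : (Gate.leaf g).source s (l + 1) X Y N =
            (Gate.leaf g).source (s + 1) l X Y N := by
          simp only [Gate.source]
          split_ifs <;> omega
        obtain ⟨e, he⟩ := hV.exits (.leaf g) ⟨by omega, by omega⟩
        rw [hsrc]
        refine hexit ?_ he
        simp only [Gate.source]
        split_ifs <;> omega
  · rw [hV.fixed i (by omega) h2 h3 h4]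
    exact fiveCycle_of_ne (by omega) (by omega) h2 h3 h4

/-- With a = s + lH + 1, each arrow of the cycle fits the labels together. a ↦ z and z ↦ X give the
last two leaves of the horizontal child their sources there (the second after `DV` has produced z).
X ↦ Y turns the black exit of the vertical child into the white exit of `p`, Y ↦ N turns its white
exit into an entrance at the black end of the horizontal child, and N ↦ a adjusts the target of its
first leaf. -/
lemma tripSpec_node_node {u : Unit} {tH tV : BinaryTree Unit} {lH lV z : ℕ} {DH DV : ℕ → ℕ}
    (hp : subtreeAt T p = some (.node u tH tV))
    (hH : TripSpec hn (.H :: p) s lH z X N DH)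
    (hV : TripSpec hn (.V :: p) (s + lH + 2) lV X Y N DV) (hz : DV (s + lH + 2) = z)
    (hz1 : s + lH + 2 ≤ z) (hz2 : z ≤ s + lH + 2 + lV) (hX : s + lH + 2 + lV < X)
    (hXY : X < Y) (hY : Y < N) :
    TripSpec hn p s (lH + lV + 2) X Y N
      fun i => DH (fiveCycle (s + lH + 1) z X Y N (DV i)) := by
  have c1 : s + lH + 1 < z := by omega
  have c2 : z < X := by omega
  have hHleaf : ∀ {d i g}, Exits hn (.H :: p) s lH z X N d i (.leaf g) →
      Exits hn p s (lH + lV + 2) X Y N d i (.leaf g) := fun ⟨h1, h2, h3⟩ =>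
    ⟨Gate.valid_mono h1 le_rfl (by omega), h2, h3⟩
  have hHexit : ∀ {d i e}, Exits hn (.H :: p) s lH z X N d i e →
      ∃ e', Exits hn p s (lH + lV + 2) X Y N d i e' := by
    rintro d i (_ | _ | g) he
    · exact ⟨.b, trivial, go_H_wOut hn hp he.2.1, he.2.2⟩
    -- Entering the vertical child at its white end, the trip ends at a leaf, so it does not
    -- oscillate between the children. The target of this leaf is `z`, the label of the black exit
    -- of the horizontal child.
    · obtain ⟨g, ⟨g1, g1'⟩, g2, g3⟩ := hV.exits_w
      refine ⟨.leaf g, ⟨by omega, by omega⟩, go_H_bOut hn he.2.1 g2, ?_⟩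
      have := he.2.2
      simp only [Gate.target] at this g3 ⊢
      rw [if_neg (by omega)]
      split_ifs at g3 <;> omega
    · exact ⟨_, hHleaf he⟩
  have hVleaf : ∀ {d i g}, i ≠ s + lH + 2 →
      Exits hn (.V :: p) (s + lH + 2) lV X Y N d (DV i) (.leaf g) →
      Exits hn p s (lH + lV + 2) X Y N d (DH (fiveCycle (s + lH + 1) z X Y N (DV i)))
        (.leaf g) := by
    rintro d i g hi ⟨⟨h1, h1'⟩, h2, h3⟩
    refine ⟨⟨by omega, by omega⟩, h2, ?_⟩
    have hne : DV i ≠ z := fun h => hi (hV.injective (h.trans hz.symm))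
    simp only [Gate.target] at h3 ⊢
    rw [if_neg (by omega)]
    split_ifs at h3 with h4
    · rw [h3, fiveCycle_N c1 c2 hXY hY, hH.fixed _ (by omega) (by omega) (by omega) (by omega)]
      omega
    · rw [fiveCycle_of_ne (by omega) hne (by omega) (by omega) (by omega),
        hH.fixed _ (by omega) hne (by omega) (by omega), h3]
  have hVexit : ∀ {d i e}, i ≠ s + lH + 2 →
      Exits hn (.V :: p) (s + lH + 2) lV X Y N d (DV i) e →
      ∃ e', Exits hn p s (lH + lV + 2) X Y N d
        (DH (fiveCycle (s + lH + 1) z X Y N (DV i))) e' := by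
    rintro d i (_ | _ | g) hi he
    -- Symmetrically, a trip that enters the horizontal child at its black end ends at a leaf there.
    · obtain ⟨g, hg⟩ := hH.exits_b
      obtain ⟨g1, g2, g3⟩ := hHleaf hg
      refine ⟨.leaf g, g1, go_V_wOut hn he.2.1 g2, ?_⟩
      rw [he.2.2, Gate.target, fiveCycle_y c1 c2 hXY, g3]
    · refine ⟨.w, trivial, go_V_bOut hn hp he.2.1, ?_⟩
      rw [he.2.2, Gate.target, Gate.target, fiveCycle_x c1 c2,
        hH.fixed _ (by omega) (by omega) (by omega) (by omega)]
    · exact ⟨_, hVleaf hi he⟩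
  have hlow : ∀ i < s + lH + 1, fiveCycle (s + lH + 1) z X Y N (DV i) = i := fun i hi => by
    rw [hV.fixed i (by omega) (by omega) (by omega) (by omega)]
    exact fiveCycle_of_ne (by omega) (by omega) (by omega) (by omega) (by omega)
  have hw : ∃ g, Exits hn p s (lH + lV + 2) X Y N (.at p .wOut)
      (DH (fiveCycle (s + lH + 1) z X Y N (DV s))) (.leaf g) := by
    obtain ⟨g, hg⟩ := hH.exits_w
    obtain ⟨g1, g2, g3⟩ := hHleaf hg
    exact ⟨g, g1, go_wOut_trans hn hp g2, by rw [hlow _ (by omega), g3]⟩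
  have hb : ∃ g, Exits hn p s (lH + lV + 2) X Y N (.at p .bOut)
      (DH (fiveCycle (s + lH + 1) z X Y N (DV N))) (.leaf g) := by
    obtain ⟨g, hg⟩ := hV.exits_b
    obtain ⟨g1, g2, g3⟩ := hVleaf (by omega) hg
    exact ⟨g, g1, go_bOut_trans hn hp g2, g3⟩
  refine ⟨?_, hw, hb, fun i h1 h2 h3 h4 => ?_,
    hH.injective.comp ((fiveCycle_injective c1 c2 hXY hY).comp hV.injective)⟩
  · rintro (_ | _ | g) hg
    · obtain ⟨g, hg⟩ := hw
      exact ⟨_, hg⟩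
    · obtain ⟨g, hg⟩ := hb
      exact ⟨_, hg⟩
    · obtain ⟨hg1, hg2⟩ := hg
      rcases le_or_gt g (s + lH + 1) with hle | hgt
      · obtain ⟨e, he⟩ := hH.exits (.leaf g) ⟨hg1, hle⟩
        have hsrc : fiveCycle (s + lH + 1) z X Y N
            (DV ((Gate.leaf g).source s (lH + lV + 2) X Y N)) =
            (Gate.leaf g).source s lH z X N := by
          simp only [Gate.source]
          rw [if_pos (by omega)]
          split_ifs with h1 h2
          · exact hlow _ (by omega)
          · rw [hV.fixed _ (by omega) (by omega) (by omega) (by omega), h2, fiveCycle_a]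
          · obtain rfl : g = s + lH + 1 := by omega
            rw [hz, fiveCycle_z c1]
        rw [hsrc]
        exact hHexit he
      · have hsrc : (Gate.leaf g).source s (lH + lV + 2) X Y N =
            (Gate.leaf g).source (s + lH + 2) lV X Y N := by
          simp only [Gate.source]
          split_ifs <;> omega
        obtain ⟨e, he⟩ := hV.exits (.leaf g) ⟨by omega, by omega⟩
        rw [hsrc]
        refine hVexit ?_ he
        simp only [Gate.source]
        split_ifs <;> omega
  · rw [hV.fixed i (by omega) h2 h3 h4, fiveCycle_of_ne (by omega) (by omega) h2 h3 h4]
    exact hH.fixed i (by omega) (by omega) h2 h4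

end Node

end

/-! ### Column labels as positions in the lower word -/

lemma exists_first_H (w : List Step) :
    ∃ A B, w ++ [.H] = A ++ .H :: B ∧ B.count .H = w.count .H := by
  induction w with
  | nil => exact ⟨[], [], rfl, rfl⟩
  | cons a w ih =>
    cases a with
    | H => exact ⟨[], w ++ [.H], by simp, by simp⟩
    | V =>
      obtain ⟨A, B, h1, h2⟩ := ih
      exact ⟨.V :: A, B, by simp [h1], by simpa using h2⟩

lemma length_leavesFrom_node (a : Unit) (t t' : BinaryTree Unit) (p : List Step) :
    (leavesFrom (.node a t t') p).length = (lowerWord (.node a t t')).length + 2 := by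
  rw [length_leavesFrom, (length_words _ (by simp)).2]

/-- The label `lab c` of a column `c` of the segment with word `w` which starts at position `s`,
where `f` is the number of the column that follows the segment. -/
def LabelsSegment (lab : ℕ → ℕ) (s f : ℕ) (w : List Step) : Prop :=
  ∀ A B, w ++ [.H] = A ++ .H :: B → lab (f + B.count .H) = s + A.length

namespace LabelsSegment

variable {lab : ℕ → ℕ} {s f : ℕ} {w w' : List Step}

/-- The segment of a subtree is always followed by a horizontal step: the `H` that closes the word
of a horizontal child, or the step of column 3 at the end of the whole word. This is the letter
appended in `LabelsSegment`. -/
lemma lab_end (h : LabelsSegment lab s f w) : lab f = s + w.length := by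
  simpa using h w [] rfl

/-- This column belongs to the first `H` of `w ++ [.H]`. It is the last column z of a row whose
vertical step directly precedes the segment. -/
lemma lab_first (h : LabelsSegment lab s f w) :
    s ≤ lab (f + w.count .H) ∧ lab (f + w.count .H) ≤ s + w.length := by
  obtain ⟨A, B, h1, h2⟩ := exists_first_H w
  have h3 := congrArg List.length h1
  simp only [List.length_append, List.length_cons, List.length_nil] at h3
  rw [← h2, h A B h1]
  omega

lemma of_append (h : LabelsSegment lab s f (w' ++ w)) :
    LabelsSegment lab (s + w'.length) f w := by
  intro A B hAB
  rw [h (w' ++ A) B (by simp [hAB]), List.length_append, add_assoc]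

lemma of_append_H (h : LabelsSegment lab s f (w ++ .H :: w')) :
    LabelsSegment lab s (f + w'.count .H + 1) w := by
  intro A B hAB
  have := h A (B ++ (w' ++ [.H])) (by
    rw [← List.cons_append, ← List.append_assoc, ← hAB]
    simp)
  rw [← this, List.count_append, List.count_append, List.count_singleton_self]
  congr 1
  omega

end LabelsSegment

variable {n : ℕ} {T : BinaryTree Unit} {hn : T.numLeaves + 2 = n}

/-- The second claim is needed in the induction: it identifies the target of the trip from the white
end of a vertical child with the label z of the row above it. By `hleaf` the first leaf of `t` has
the number `s`, the position of its first letter, so leaves and labels share one numbering. -/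
theorem tripSpec_tree (lab : ℕ → ℕ) (N : ℕ) (t : BinaryTree Unit) (p : List Step)
    (s f x y : ℕ) (ht : t ≠ .nil) (hp : subtreeAt T p = some t)
    (hleaf : ∃ A B, leafList T = A ++ (leavesFrom t p ++ B) ∧ A.length = s)
    (hlab : LabelsSegment lab s f (lowerWord t)) (hx : s + (lowerWord t).length < lab x)
    (hxy : lab x < lab y) (hy : lab y < N) :
    TripSpec hn p s (lowerWord t).length (lab x) (lab y) N (rowsMap lab N (rowsOf t s f x y)) ∧
      rowsMap lab N (rowsOf t s f x y) s = lab (f + (lowerWord t).count .H) := by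
  obtain ⟨A, B, hA, rfl⟩ := hleaf
  generalize hs : A.length = s at *
  fun_induction rowsOf t s f x y generalizing p A B with
  | case1 => exact absurd rfl ht
  | case2 u s f x y =>
    subst hs
    refine ⟨tripSpec_leaf_leaf hp ?_ ?_, ?_⟩
    · simp [hA, leavesFrom]
    · simp [hA, leavesFrom]
    · simpa [lowerWord] using hlab.lab_end.symm
  | case3 u a t t' s f x y ih =>
    rw [lowerWord] at *
    have hl := hlab.lab_end
    simp only [List.length_append, List.length_singleton, ← add_assoc] at *
    have hw := ih (.H :: p) (by simp) (by simp [subtreeAt, hp, child]) (by omega) (by omega) A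
      (leavesFrom .nil (.V :: p) ++ B) (by rw [hA]; simp [leavesFrom]) hs
      hlab.of_append_H (by omega)
    -- Column `f` is that of the closing `H`, with label s + l + 1, as `tripSpec_node_leaf` expects.
    rw [hl] at hw
    refine ⟨tripSpec_node_leaf hp ?_ hw.1 (by omega) hxy hy, ?_⟩
    · rw [hA, leavesFrom, List.getD_append_right _ _ _ _ (by omega),
        List.append_assoc, List.getD_append_right _ _ _ _
          (by rw [length_leavesFrom_node]; omega), length_leavesFrom_node]
      have : s + (lowerWord (.node a t t')).length + 2 - A.length -
        ((lowerWord (.node a t t')).length + 2) = 0 := by omega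
      rw [this]
      simp [leavesFrom]
    · rw [hw.2]
      congr 1
      simp
      omega
  | case4 u b z w s f x y ih =>
    rw [lowerWord] at *
    have hl : LabelsSegment lab (s + 1) f _ := hlab.of_append (w' := [.V])
    have hz := hl.lab_first
    simp only [List.length_cons] at *
    have hw := ih (.V :: p) (by simp) (by simp [subtreeAt, hp, child]) hxy hy
      (A ++ leavesFrom .nil (.H :: p)) B
      (by rw [hA]; simp [leavesFrom]) (by simp [leavesFrom, hs]) hl (by omega)
    refine ⟨tripSpec_leaf_node hp ?_ hw.1 hw.2 hz.1 hz.2 (by omega) hxy hy, ?_⟩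
    · rw [hA, leavesFrom, List.getD_append_right _ _ _ _ (by omega), hs]
      simp [leavesFrom]
    · rw [rowsMap_cons, hw.1.fixed s (by omega) (by omega) (by omega) (by omega), fiveCycle_a]
      simp
  | case5 u a t t' b z w s f x y ih1 ih2 =>
    rw [lowerWord, List.append_assoc, List.singleton_append] at *
    have hlV : LabelsSegment lab (s + (lowerWord (.node a t t')).length + 2) f
        (lowerWord (.node b z w)) := by
      have := LabelsSegment.of_append (w' := lowerWord (.node a t t') ++ [.H, .V])
        (w := lowerWord (.node b z w)) (by simpa using hlab)
      simpa [add_assoc] using this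
    have hlH := hlab.of_append_H
    rw [List.count_cons_of_ne (by decide)] at hlH
    have hz := hlV.lab_first
    simp only [List.length_append, List.length_cons] at *
    have hwV := ih2 (.V :: p) (by simp) (by simp [subtreeAt, hp, child]) hxy hy
      (A ++ leavesFrom (.node a t t') (.H :: p)) B
      (by rw [hA, leavesFrom, List.append_assoc, List.append_assoc])
      (by rw [List.length_append, length_leavesFrom_node]; omega) hlV (by omega)
    have hwH := ih1 (.H :: p) (by simp) (by simp [subtreeAt, hp, child]) (by omega) (by omega) A
      (leavesFrom (.node b z w) (.V :: p) ++ B)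
      (by rw [hA, leavesFrom, List.append_assoc]) hs hlH (by omega)
    have hnode := tripSpec_node_node hp hwH.1 hwV.1 hwV.2 hz.1 hz.2 (by omega) hxy hy
    have hD : rowsMap lab N (rowsOf (.node u (.node a t t') (.node b z w)) s f x y) = fun i =>
        rowsMap lab N (rowsOf (.node a t t') s (f + (lowerWord (.node b z w)).count .H + 1)
          (f + (lowerWord (.node b z w)).count .H) x)
          (fiveCycle (s + (lowerWord (.node a t t')).length + 1)
            (lab (f + (lowerWord (.node b z w)).count .H)) (lab x) (lab y) N
            (rowsMap lab N (rowsOf (.node b z w)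
              (s + (lowerWord (.node a t t')).length + 2) f x y) i)) := by
      funext i
      rw [rowsOf, rowsMap_append, rowsMap_cons]
    rw [rowsOf] at hD
    rw [hD]
    refine ⟨by convert hnode using 1; omega, ?_⟩
    simp only
    -- The label `s` lies before the row and the vertical child, so only the horizontal factor moves
    -- it.
    rw [hwV.1.fixed s (by omega) (by omega) (by omega) (by omega),
      fiveCycle_of_ne (by omega) (by omega) (by omega) (by omega) (by omega), hwH.2]
    congr 1
    simp
    omega

/-! ### Labels in the diagram of a pair of paths -/

namespace PathPair

variable {n k : ℕ} (W : PathPair n k)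

lemma colLabel_of_le {c : ℕ} (hc : c ≤ 3) : (omegaLD W).colLabel c + (c + 1) = n := by
  have h1 : (omegaLD W).shape.colLen c = k := by
    refine (colLen_pathDiagram 4 W.lower c).trans ?_
    rw [List.filter_eq_self.2, length_pathRowLens, W.count_lower]
    intro v _
    simp
    omega
  have := W.count_H_lower
  rw [OplusDiagram.colLabel, h1]
  omega

lemma colLabel_of_eq_append {A B : List Step} (h : W.lower = A ++ .H :: B) :
    (omegaLD W).colLabel (B.count .H + 4) = A.length := by
  have h1 : (omegaLD W).shape.colLen (B.count .H + 4) = A.count .V := by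
    refine (colLen_pathDiagram 4 W.lower _).trans ?_
    rw [← length_filter_pathRowLens A B, ← h]
    simp
  have h2 := W.count_H_lower
  have h3 := count_H_add_count_V A
  rw [h, List.count_append, List.count_cons_self] at h2
  rw [OplusDiagram.colLabel, h1]
  omega

/-- The appended `H` is the step under column 3, the rightmost of the four extra columns. An `H` of
the word with j letters `H` after it belongs to column j + 4. -/
lemma labelsSegment : LabelsSegment (omegaLD W).colLabel 0 3 W.lower := by
  intro A B h
  rcases List.eq_nil_or_concat B with rfl | ⟨B, a, rfl⟩
  · obtain ⟨rfl, -⟩ := List.append_inj' h rfl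
    have h1 := W.colLabel_of_le (c := 3) le_rfl
    have h2 := W.length_lower
    simp only [List.count_nil, Nat.add_zero]
    omega
  · rw [List.concat_eq_append, ← List.cons_append, ← List.append_assoc] at h
    obtain ⟨h1, h2⟩ := List.append_inj' h rfl
    obtain rfl := List.singleton_inj.1 h2
    rw [List.concat_eq_append, List.count_append, List.count_singleton_self, zero_add,
      ← W.colLabel_of_eq_append h1]
    congr 1
    omega

lemma rowPlus_of_rowSpec {r : ℕ} {q : ℕ × ℕ × ℕ × ℕ} (h : W.RowSpec W.emptyBoxes r q) :
    (omegaLD W).RowPlus r q :=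
  ⟨h.label, h.last, h.x_lt, h.y_lt, h.y_pos, W.mem_plusBoxes_of_rowSpec h⟩

end PathPair

/-! ### The whole tree -/

section

variable {n k : ℕ} (T : CompleteTree n k)

/-- The rows of the diagram of a tree. -/
abbrev CompleteTree.rows : List (ℕ × ℕ × ℕ × ℕ) := rowsOf T.tree 0 3 2 1

/-- Initially columns 2 and 1 are available; column 0 always carries `+`, and column 3 is the next
one. -/
lemma CompleteTree.pathRun :
    PathRun 3 0 (omegaTL T).lower (omegaTL T).upper [2, 1] T.rows [2, 1] :=
  PathRun.tree T.tree 0 3 2 1 []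

lemma CompleteTree.length_rows : T.rows.length = k :=
  T.pathRun.length_rows.trans (omegaTL T).count_lower

lemma CompleteTree.rowPlus (r : ℕ) (q : ℕ × ℕ × ℕ × ℕ) (h : T.rows[r]? = some q) :
    (omegaLD (omegaTL T)).RowPlus r q := by
  refine (omegaTL T).rowPlus_of_rowSpec ?_
  have h1 := (T.pathRun.spec (omegaTL T) (A := []) (B := []) rfl rfl rfl rfl
    (fun _ => .inl rfl)).2 r q h
  rw [PathPair.emptyBoxes_eq]
  simpa using h1

/-- The boundary vertex at a gate of the whole tree. -/
def Gate.bdry (n : ℕ) : Gate → ℕ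
  | w => 0
  | b => n - 1
  | leaf g => g + 1

lemma Gate.dart_eq_rawRev {e : Gate} {l : ℕ} (hl : l + 4 = n) (he : e.Valid 0 l)
    (h : e.bdry n < n) :
    e.dart T.tree [] = rawRev T.tree T.leaves (.bdry ⟨e.bdry n, h⟩) := by
  cases e with
  | w => simp [Gate.dart, Gate.bdry, rawRev]
  | b =>
    have : n - 1 ≠ 0 := by omega
    simp [Gate.dart, Gate.bdry, rawRev, this]
  | leaf g =>
    obtain ⟨-, h2⟩ := he
    have : g + 1 ≠ n - 1 := by omega
    simp [Gate.dart, Gate.bdry, rawRev, this]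

lemma exists_gate {l : ℕ} (hl : l + 4 = n) (i : Fin n) :
    ∃ e : Gate, e.Valid 0 l ∧ e.bdry n = i := by
  have := i.2
  rcases Nat.eq_zero_or_pos (i : ℕ) with h0 | h0
  · exact ⟨.w, trivial, h0.symm⟩
  rcases eq_or_ne (i : ℕ) (n - 1) with h1 | h1
  · exact ⟨.b, trivial, h1.symm⟩
  · exact ⟨.leaf (i - 1), ⟨by omega, by omega⟩, by simp only [Gate.bdry]; omega⟩

lemma Gate.bdry_lt {e : Gate} {l : ℕ} (hl : l + 4 = n) (he : e.Valid 0 l) : e.bdry n < n := by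
  cases e with
  | leaf g =>
    obtain ⟨-, h2⟩ := he
    simp only [Gate.bdry]
    omega
  | _ => simp only [Gate.bdry]; omega

lemma Gate.source_eq_bdry {e : Gate} {l : ℕ} (hl : l + 4 = n) (he : e.Valid 0 l) :
    e.source 0 l (n - 3) (n - 2) (n - 1) = e.bdry n := by
  cases e with
  | leaf g =>
    obtain ⟨-, h2⟩ := he
    simp only [Gate.bdry, Gate.source]
    split_ifs <;> omega
  | _ => rfl

lemma longCycle_val (i : Fin n) :
    (longCycle n i : ℕ) = if (i : ℕ) = 0 then n - 1 else (i : ℕ) - 1 := by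
  obtain ⟨j, rfl⟩ := (finRotate n).surjective i
  rw [show longCycle n (finRotate n j) = j from (finRotate n).symm_apply_apply j]
  obtain ⟨m, rfl⟩ : ∃ m, n = m + 1 := ⟨n - 1, by have := j.2; omega⟩
  rcases eq_or_ne j (Fin.last m) with rfl | hj
  · simp
  · rw [coe_finRotate_of_ne_last hj]
    simp

/-- With zero-based labels c_n² subtracts 2 modulo n; only the white end (vertex 0) and the first
leaf (vertex 1) wrap around, to Y = n - 2 and N = n - 1. -/
lemma Gate.target_eq {e : Gate} {l : ℕ} (hl : l + 4 = n) (he : e.Valid 0 l) (i : Fin n)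
    (hi : e.bdry n = i) :
    e.target 0 (n - 3) (n - 2) (n - 1) = ((longCycle n ^ 2) i : Fin n) := by
  have h1 := longCycle_val i
  have h2 := longCycle_val (longCycle n i)
  rw [pow_two, Equiv.Perm.mul_apply, h2]
  cases e with
  | leaf g =>
    obtain ⟨-, h3⟩ := he
    simp only [Gate.bdry, Gate.target] at hi ⊢
    split_ifs at h1 ⊢ <;> omega
  | _ =>
    simp only [Gate.bdry, Gate.target] at hi ⊢
    split_ifs at h1 ⊢ <;> omega

theorem pipe_eq_longCycle_sq_tripEnd (i : Fin n) :
    (omegaLD (omegaTL T)).pipe i = (longCycle n ^ 2) ((plabicGraph T).tripEnd i) := by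
  set W := omegaTL T
  set lab := (omegaLD W).colLabel with hlab
  have h0 : lab 0 = n - 1 := by
    have : lab 0 + (0 + 1) = n := W.colLabel_of_le (by omega)
    omega
  have h1 : lab 1 = n - 2 := by
    have : lab 1 + (1 + 1) = n := W.colLabel_of_le (by omega)
    omega
  have h2 : lab 2 = n - 3 := by
    have : lab 2 + (2 + 1) = n := W.colLabel_of_le (by omega)
    omega
  have hl : W.lower.length + 4 = n := W.length_lower
  have hspec := (tripSpec_tree (hn := T.leaves) lab (n - 1) T.tree [] 0 3 2 1 T.ne_nil rfl
    ⟨[], [], by simp [leafList], rfl⟩ W.labelsSegment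
    (by rw [h2]; change 0 + W.lower.length < _; omega) (by omega) (by omega)).1
  rw [h1, h2] at hspec
  obtain ⟨e, he, hei⟩ := exists_gate hl i
  obtain ⟨e', he', hgo, htarget⟩ := hspec.exits e he
  have hlt := Gate.bdry_lt hl he'
  have htrip : (plabicGraph T).tripEnd i = ⟨e'.bdry n, hlt⟩ := by
    refine Go.tripEnd_eq T ?_
    rw [Gate.dart_eq_rawRev T hl he (Gate.bdry_lt hl he),
      Gate.dart_eq_rawRev T hl he' hlt] at hgo
    have : (⟨e.bdry n, Gate.bdry_lt hl he⟩ : Fin n) = i := Fin.ext hei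
    rwa [this] at hgo
  refine Fin.ext ?_
  rw [OplusDiagram.pipe_eq_rowsMap T.length_rows T.rowPlus i, ← hlab, h0, htrip, ← hei,
    ← Gate.source_eq_bdry hl he]
  exact htarget.trans (Gate.target_eq hl he' _ rfl)

end

end BCFW

theorem mainTheorem3 (n k : ℕ) (T : BCFW.CompleteTree n k) :
    (BCFW.omegaLD (BCFW.omegaTL T)).decPerm =
      BCFW.DecoratedPerm.allBlack (BCFW.longCycle n ^ 2 * (BCFW.plabicGraph T).tripPerm) := by
  refine BCFW.DecoratedPerm.ext (Equiv.ext fun i => BCFW.pipe_eq_longCycle_sq_tripEnd T i) ?_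
  refine BCFW.OplusDiagram.decPerm_white_eq_empty _ fun r hr => ?_
  have h := T.rowPlus r _ (List.getElem?_eq_getElem (by rw [T.length_rows]; exact hr))
  exact ⟨_, h.last.symm, (h.mem _).2 (by simp)⟩
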